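/- Let $N\ge 1$ and let $\Omega\subset\mathbb{R}^N$ be a bounded domain (a non-empty, bounded, connected open set). Put $c_N=\pi^{-N/2}\,\Gamma(N/2)$ and $\rho_N=2\ln 2+\psi(N/2)-\gamma$, where $\psi=\Gamma'/\Gamma$ and $\gamma$ is the Euler--Mascheroni constant. Let $\mathbb{H}(\Omega)$ be the space of all measurable functions $u:\mathbb{R}^N\to\mathbb{R}$ with $u\equiv 0$ in $\mathbb{R}^N\setminus\Omega$ and $$\iint_{|x-y|\le 1}\frac{(u(x)-u(y))^2}{|x-y|^N}\,dx\,dy<\infty ,$$ and for $u,w\in\mathbb{H}(\Omega)$ let $$\mathcal{E}_L(u,w)=\frac{c_N}{2}\iint_{|x-y|\le 1}\frac{(u(x)-u(y))(w(x)-w(y))}{|x-y|^N}\,dx\,dy-c_N\iint_{|x-y|\ge 1}\frac{u(x)w(y)}{|x-y|^N}\,dx\,dy+\rho_N\int_{\mathbb{R}^N}u\,w\,dx ,$$ the quadratic form of the logarithmic Laplacian (the operator with Fourier symbol $2\ln|\xi|$). A function $u\in\mathbb{H}(\Omega)$, not a.e. zero, is a Dirichlet eigenfunction of the logarithmic Laplacian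 in $\Omega$ with eigenvalue $\lambda\in\mathbb{R}$ if $\mathcal{E}_L(u,\varphi)=\lambda\int_\Omega u\,\varphi\,dx$ for all $\varphi\in\mathbb{H}(\Omega)$. Then the Dirichlet eigenvalues, repeated according to multiplicity, form a sequence $\lambda_1(\Omega)\le\lambda_2(\Omega)\le\cdots$, that is, there are a nondecreasing real sequence $(\lambda_k(\Omega))_{k\ge1}$ and an orthonormal basis $(\phi_k)_{k\ge1}$ of $L^2(\Omega)$ such that each $\phi_k$ is (after extension by zero, and up to equality almost everywhere) a Dirichlet eigenfunction with eigenvalue $\lambda_k(\Omega)$; and for every such sequence $$\lim_{k\to\infty}\frac{\lambda_k(\Omega)}{\ln k}=\frac{2}{N}.$$ In particular, the limit does not depend on $|\Omega|$. -/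

import Mathlib

open MeasureTheory Filter Topology

noncomputable section

namespace LogLaplacian

variable {N : ℕ}

/-- The constant `c_N = π^(-N/2) Γ(N/2)`. -/
def cConst (N : ℕ) : ℝ :=
  Real.pi ^ (-(N : ℝ) / 2) * Real.Gamma ((N : ℝ) / 2)

/-- The digamma function `ψ = Γ' / Γ` on the reals. -/
def digamma (x : ℝ) : ℝ := logDeriv Real.Gamma x

/-- The constant `ρ_N = 2 ln 2 + ψ(N/2) - γ`. -/
def rhoConst (N : ℕ) : ℝ :=
  2 * Real.log 2 + digamma ((N : ℝ) / 2) - Real.eulerMascheroniConstant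

/-- Pairs of points at distance at most one. -/
def nearSet (N : ℕ) : Set (EuclideanSpace ℝ (Fin N) × EuclideanSpace ℝ (Fin N)) :=
  {p | ‖p.1 - p.2‖ ≤ 1}

/-- Pairs of points at distance at least one. -/
def farSet (N : ℕ) : Set (EuclideanSpace ℝ (Fin N) × EuclideanSpace ℝ (Fin N)) :=
  {p | 1 ≤ ‖p.1 - p.2‖}

/-- The form domain `ℍ(Ω)`: (Lebesgue) measurable functions `u : ℝ^N → ℝ` that vanish outside `Ω`
and satisfy `∬_{|x-y| ≤ 1} (u(x) - u(y))² / |x-y|^N dx dy < ∞`. -/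
structure MemH (Ω : Set (EuclideanSpace ℝ (Fin N))) (u : EuclideanSpace ℝ (Fin N) → ℝ) :
    Prop where
  aemeasurable : AEMeasurable u volume
  eq_zero : ∀ x, x ∉ Ω → u x = 0
  integrableOn : IntegrableOn
    (fun p : EuclideanSpace ℝ (Fin N) × EuclideanSpace ℝ (Fin N) =>
      (u p.1 - u p.2) ^ 2 / ‖p.1 - p.2‖ ^ N) (nearSet N) volume

/-- The inner product
`ℰ(u,w) = (c_N / 2) ∬_{|x-y| ≤ 1} (u(x)-u(y)) (w(x)-w(y)) / |x-y|^N dx dy`. -/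
def innerForm (u w : EuclideanSpace ℝ (Fin N) → ℝ) : ℝ :=
  cConst N / 2 * ∫ p in nearSet N, (u p.1 - u p.2) * (w p.1 - w p.2) / ‖p.1 - p.2‖ ^ N

/-- The quadratic form of the logarithmic Laplacian,
`ℰ_L(u,w) = ℰ(u,w) - c_N ∬_{|x-y| ≥ 1} u(x) w(y) / |x-y|^N dx dy + ρ_N ∫ u w dx`. -/
def logForm (u w : EuclideanSpace ℝ (Fin N) → ℝ) : ℝ :=
  innerForm u w - cConst N * (∫ p in farSet N, u p.1 * w p.2 / ‖p.1 - p.2‖ ^ N)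
    + rhoConst N * ∫ x, u x * w x

/-- `u` is an eigenfunction with eigenvalue `μ` of the Dirichlet problem
`L_Δ u = μ u` in `Ω`, `u = 0` in `ℝ^N ∖ Ω`, in the weak sense. -/
structure IsDirichletEigenfunction (Ω : Set (EuclideanSpace ℝ (Fin N))) (μ : ℝ)
    (u : EuclideanSpace ℝ (Fin N) → ℝ) : Prop where
  memH : MemH Ω u
  ne_zero : ¬ u =ᵐ[volume] 0
  weak_eq : ∀ φ : EuclideanSpace ℝ (Fin N) → ℝ, MemH Ω φ →
    logForm u φ = μ * ∫ x in Ω, u x * φ x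

/-- `lam 0 ≤ lam 1 ≤ ⋯` is the sequence of all Dirichlet eigenvalues of the logarithmic Laplacian
in `Ω`, repeated according to multiplicity: the sequence is nondecreasing, and there is an
orthonormal (Hilbert) basis of `L²(Ω)` whose `k`-th member is an eigenfunction for `lam k`.
The indices start at `0`, so that `lam k` is the eigenvalue usually written `λ_{k+1}(Ω)`. -/
def IsDirichletEigenvalueSequence (Ω : Set (EuclideanSpace ℝ (Fin N))) (lam : ℕ → ℝ) : Prop :=
  Monotone lam ∧
    ∃ b : HilbertBasis ℕ ℝ (Lp ℝ 2 ((volume : Measure (EuclideanSpace ℝ (Fin N))).restrict Ω)),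
      ∀ k, ∃ u : EuclideanSpace ℝ (Fin N) → ℝ,
        IsDirichletEigenfunction Ω (lam k) u ∧ u =ᵐ[volume.restrict Ω] (b k)

end LogLaplacian

end

/-! The kernel |h|^(-N) is borderline non-integrable: c_N times its mass on δ ≤ |h| ≤ 1 is exactly 2
ln(1/δ). Resolving functions at scale δ therefore costs energy 2 ln(1/δ), and k orthogonal functions
on Ω need the scale δ ~ k^(-1/N). This gives (2/N) ln k per function, and |Ω| affects only bounded
terms.

Lower bound (`formMap_coercive`, `trace_ge`). Discarding distances below δ leaves 2 ln(1/δ)‖u‖²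
minus c_N times the pairing of u with k_δ * u, where k_δ is the truncated kernel. By Young's
inequality this pairing is at most half of ‖u‖² plus the squared norm of k_δ * u on Ω. For an
orthonormal system, Bessel's inequality at each point x bounds the sum of |k_δ * φ_i(x)|² by ‖k_δ‖²
= O(δ^(-N)), independently of the number of functions. With δ = k^(-1/N) the total error is O(k), so
every trace over k orthonormal functions is at least k((2/N) ln k - C).

Upper bound (`exists_trial`). Tent functions on k disjoint balls of radius comparable to k^(-1/N)
are orthogonal and have Rayleigh quotient at most (2/N) ln k + C. Ky Fan's inequality
`IsEigenfamily.sum_le_trace` bounds the eigenvalue sum by their trace, so off-diagonal entries of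
the form need no estimate. Monotonicity turns the two bounds on partial sums into bounds on single
eigenvalues (`tendsto_div_log_of_sum_bounds`).

Existence comes from successive minimization of the Rayleigh quotient. The needed compactness
follows from the same coercivity estimate: the coefficient 2 ln(1/δ) can be made arbitrarily large,
while k_δ * u is compact in u for fixed δ. -/

open MeasureTheory Filter Topology

noncomputable section

namespace LogLaplacian

/-! ### Spectral theory of a semibounded form with compact sublevel sets -/

section Abstract

variable {V : Type*} [NormedAddCommGroup V] [InnerProductSpace ℝ V]

/-- The form `B` has relatively compact sublevel sets on the unit ball and is lower
semicontinuous along sequences. -/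
def FormCompact (B : V →ₗ[ℝ] V →ₗ[ℝ] ℝ) : Prop :=
  ∀ (u : ℕ → V) (t : ℕ → ℝ) (c : ℝ), (∀ n, ‖u n‖ ≤ 1) → (∀ n, B (u n) (u n) ≤ t n) →
    Tendsto t atTop (𝓝 c) →
    ∃ (w : V) (φ : ℕ → ℕ), StrictMono φ ∧ Tendsto (u ∘ φ) atTop (𝓝 w) ∧ B w w ≤ c

/-- The unit vectors orthogonal to a given set. -/
def unitOrthogonal (s : Set V) : Set V := {u | ‖u‖ = 1 ∧ ∀ v ∈ s, inner ℝ v u = 0}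

/-- The space V need not be complete (it will be the form domain with the L² norm), but a finite
span is, so it still has an orthogonal complement. -/
theorem unitOrthogonal_nonempty (hinf : ¬ FiniteDimensional ℝ V) {s : Set V} (hs : s.Finite) :
    (unitOrthogonal s).Nonempty := by
  have hfin : FiniteDimensional ℝ (Submodule.span ℝ s) := FiniteDimensional.span_of_finite ℝ hs
  have hne : (Submodule.span ℝ s)ᗮ ≠ ⊥ := by
    intro h
    rw [Submodule.orthogonal_eq_bot_iff] at h
    rw [h] at hfin
    exact hinf (Submodule.topEquiv (R := ℝ) (M := V)).finiteDimensional
  obtain ⟨x, hx, hx0⟩ := Submodule.exists_mem_ne_zero_of_ne_bot hne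
  refine ⟨‖x‖⁻¹ • x, ?_, fun v hv => ?_⟩
  · rw [norm_smul, norm_inv, norm_norm, inv_mul_cancel₀ (norm_ne_zero_iff.2 hx0)]
  · rw [inner_smul_right, (Submodule.mem_orthogonal _ x).1 hx v (Submodule.subset_span hv), mul_zero]

theorem unitOrthogonal_anti {s t : Set V} (h : s ⊆ t) : unitOrthogonal t ⊆ unitOrthogonal s :=
  fun _ hu => ⟨hu.1, fun v hv => hu.2 v (h hv)⟩

variable {B : V →ₗ[ℝ] V →ₗ[ℝ] ℝ}

theorem exists_minimizer (hinf : ¬ FiniteDimensional ℝ V) (hcpt : FormCompact B) {C : ℝ}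
    (hbdd : ∀ u, -C * ‖u‖ ^ 2 ≤ B u u) {s : Set V} (hs : s.Finite) :
    ∃ u ∈ unitOrthogonal s, ∀ w ∈ unitOrthogonal s, B u u ≤ B w w := by
  set A : Set ℝ := (fun u => B u u) '' unitOrthogonal s
  have hA : A.Nonempty := (unitOrthogonal_nonempty hinf hs).image _
  have hAb : BddBelow A := by
    refine ⟨-C, ?_⟩
    rintro _ ⟨u, hu, rfl⟩
    simpa [hu.1] using hbdd u
  obtain ⟨t, -, ht, htA⟩ := exists_seq_tendsto_sInf hA hAb
  choose u hu hut using htA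
  obtain ⟨w, φ, hφ, hw, hBw⟩ := hcpt u t (sInf A) (fun n => (hu n).1.le) (fun n => (hut n).le) ht
  refine ⟨w, ⟨?_, fun v hv => ?_⟩, fun x hx => hBw.trans (csInf_le hAb ⟨x, hx, rfl⟩)⟩
  -- Convergence is in norm, so the constraints survive in the limit; a weak limit could lose mass.
  · exact tendsto_nhds_unique hw.norm (by simp [(hu _).1])
  · refine tendsto_nhds_unique (tendsto_const_nhds.inner hw) ?_
    simp [(hu _).2 v hv]

/-- A first-order condition: a nonnegative quadratic polynomial vanishing at `0` has no linear
term. -/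
theorem eq_zero_of_forall_quadratic_nonneg {a b : ℝ} (h : ∀ t : ℝ, 0 ≤ 2 * t * b + t ^ 2 * a) :
    b = 0 := by
  have h1 : ∀ t : ℝ, 0 ≤ a * (t * t) + (2 * b) * t + 0 := fun t => by linarith [h t]
  have := discrim_le_zero h1
  simp only [discrim] at this
  nlinarith [sq_nonneg b]

theorem sublevel_of_minimizer {s : Set V} {u : V}
    (hmin : ∀ w ∈ unitOrthogonal s, B u u ≤ B w w) {v : V} (hv : ∀ x ∈ s, inner ℝ x v = 0) :
    B u u * ‖v‖ ^ 2 ≤ B v v := by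
  rcases eq_or_ne v 0 with rfl | hv0
  · simp
  have hn := norm_ne_zero_iff.2 hv0
  have := hmin (‖v‖⁻¹ • v) ⟨by rw [norm_smul, norm_inv, norm_norm, inv_mul_cancel₀ hn],
    fun x hx => by rw [inner_smul_right, hv x hx, mul_zero]⟩
  simp only [map_smul, LinearMap.smul_apply, smul_eq_mul] at this
  calc B u u * ‖v‖ ^ 2 ≤ (‖v‖⁻¹ * (‖v‖⁻¹ * B v v)) * ‖v‖ ^ 2 := by gcongr
    _ = B v v := by field_simp

/-- First variation: inserting u + t • v into the homogeneous inequality gives a quadratic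
polynomial in t that is nonnegative and vanishes at 0. -/
theorem minimizer_weak_eq (hsymm : ∀ u v, B u v = B v u) {s : Set V} {u : V}
    (hu : u ∈ unitOrthogonal s) (hmin : ∀ w ∈ unitOrthogonal s, B u u ≤ B w w) {v : V}
    (hv : ∀ x ∈ s, inner ℝ x v = 0) : B u v = B u u * inner ℝ u v := by
  have key : B u v - B u u * inner ℝ u v = 0 := by
    refine eq_zero_of_forall_quadratic_nonneg (a := B v v - B u u * ‖v‖ ^ 2) fun t => ?_
    have h := sublevel_of_minimizer hmin (v := u + t • v) fun x hx => by
      rw [inner_add_right, inner_smul_right, hu.2 x hx, hv x hx]; ring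
    rw [norm_add_sq_real, norm_smul, inner_smul_right, hu.1] at h
    simp only [map_add, map_smul, LinearMap.add_apply, LinearMap.smul_apply, smul_eq_mul,
      Real.norm_eq_abs, mul_pow, sq_abs, hsymm v u] at h
    nlinarith [h]
  linarith

/-- Successive choice: the `n`-th term is selected from the set of the preceding ones. -/
def successive (G : Set V → V) : ℕ → V
  | n => G (Set.range fun m : Fin n => successive G m)
decreasing_by exact m.2

/-- A family of eigenvectors of the form `B`. -/
structure IsEigenfamily (B : V →ₗ[ℝ] V →ₗ[ℝ] ℝ) (lam : ℕ → ℝ) (e : ℕ → V) : Prop where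
  mono : Monotone lam
  orthonormal : Orthonormal ℝ e
  weak_eq : ∀ k v, B (e k) v = lam k * inner ℝ (e k) v

/-- The `n`-th partial sum of the Fourier expansion. -/
def partialSum (e : ℕ → V) (u : V) (n : ℕ) : V := ∑ j ∈ Finset.range n, inner ℝ (e j) u • e j

theorem inner_partialSum {e : ℕ → V} (he : Orthonormal ℝ e) (u : V) {n j : ℕ} (hj : j < n) :
    inner ℝ (e j) (partialSum e u n) = inner ℝ (e j) u :=
  he.inner_right_sum _ (Finset.mem_range.2 hj)

theorem inner_sub_partialSum {e : ℕ → V} (he : Orthonormal ℝ e) (u : V) {n j : ℕ} (hj : j < n) :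
    inner ℝ (e j) (u - partialSum e u n) = 0 := by
  rw [inner_sub_right, inner_partialSum he u hj, sub_self]

theorem norm_sub_partialSum_sq {e : ℕ → V} (he : Orthonormal ℝ e) (u : V) (n : ℕ) :
    ‖u - partialSum e u n‖ ^ 2 = ‖u‖ ^ 2 - ∑ j ∈ Finset.range n, inner ℝ (e j) u ^ 2 := by
  have h0 : inner ℝ (partialSum e u n) (u - partialSum e u n) = 0 := by
    conv_lhs => arg 2; rw [partialSum]
    rw [sum_inner]
    refine Finset.sum_eq_zero fun j hj => ?_
    rw [inner_smul_left, inner_sub_partialSum he u (Finset.mem_range.1 hj), mul_zero]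
  have h1 : inner ℝ u (partialSum e u n) = ∑ j ∈ Finset.range n, inner ℝ (e j) u ^ 2 := by
    rw [partialSum, inner_sum]
    refine Finset.sum_congr rfl fun j _ => ?_
    rw [inner_smul_right, real_inner_comm, sq]
  rw [norm_sub_sq_real]
  rw [inner_sub_right, real_inner_comm, h1, real_inner_self_eq_norm_sq] at h0
  rw [h1]; linarith

theorem IsEigenfamily.form_sub_partialSum {lam : ℕ → ℝ} {e : ℕ → V} (h : IsEigenfamily B lam e)
    (hsymm : ∀ u v, B u v = B v u) (u : V) (n : ℕ) :
    B (u - partialSum e u n) (u - partialSum e u n) =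
      B u u - ∑ j ∈ Finset.range n, lam j * inner ℝ (e j) u ^ 2 := by
  have h0 : B (partialSum e u n) (u - partialSum e u n) = 0 := by
    conv_lhs => arg 1; rw [partialSum]
    rw [map_sum, LinearMap.sum_apply]
    refine Finset.sum_eq_zero fun j hj => ?_
    rw [map_smul, LinearMap.smul_apply, h.weak_eq,
      inner_sub_partialSum h.orthonormal u (Finset.mem_range.1 hj), mul_zero, smul_zero]
  have h1 : B (partialSum e u n) u = ∑ j ∈ Finset.range n, lam j * inner ℝ (e j) u ^ 2 := by
    rw [partialSum, map_sum, LinearMap.sum_apply]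
    refine Finset.sum_congr rfl fun j _ => ?_
    rw [map_smul, LinearMap.smul_apply, h.weak_eq, smul_eq_mul]; ring
  rw [map_sub B, LinearMap.sub_apply, h0, map_sub, hsymm u (partialSum e u n), h1, sub_zero]

/-- The remainder is orthogonal to the first n eigenvectors, so lam n times its squared norm is at
most its form value, which stays bounded in n. Since lam n → ∞, the remainder vanishes. -/
theorem IsEigenfamily.tendsto_partialSum {lam : ℕ → ℝ} {e : ℕ → V} (h : IsEigenfamily B lam e)
    (hsymm : ∀ u v, B u v = B v u) {C : ℝ} (hbdd : ∀ u, -C * ‖u‖ ^ 2 ≤ B u u)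
    (htop : Tendsto lam atTop atTop)
    (hmin : ∀ u k, (∀ j < k, inner ℝ (e j) u = 0) → lam k * ‖u‖ ^ 2 ≤ B u u) (u : V) :
    Tendsto (partialSum e u) atTop (𝓝 u) := by
  have hC : ∀ j, -|C| ≤ lam j := fun j => by
    have h1 := hbdd (e j)
    rw [h.weak_eq, real_inner_self_eq_norm_sq, h.orthonormal.1 j] at h1
    linarith [le_abs_self C]
  have hle : ∀ n, lam n * ‖u - partialSum e u n‖ ^ 2 ≤ B u u + |C| * ‖u‖ ^ 2 := fun n => by
    refine (hmin _ n fun j hj => inner_sub_partialSum h.orthonormal u hj).trans ?_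
    rw [h.form_sub_partialSum hsymm]
    have h2 : ∑ j ∈ Finset.range n, -|C| * inner ℝ (e j) u ^ 2 ≤
        ∑ j ∈ Finset.range n, lam j * inner ℝ (e j) u ^ 2 :=
      Finset.sum_le_sum fun j _ => mul_le_mul_of_nonneg_right (hC j) (sq_nonneg _)
    rw [← Finset.mul_sum] at h2
    have h3 := norm_sub_partialSum_sq h.orthonormal u n
    nlinarith [sq_nonneg ‖u - partialSum e u n‖, abs_nonneg C]
  have hsq : Tendsto (fun n => ‖u - partialSum e u n‖ ^ 2) atTop (𝓝 0) := by
    refine squeeze_zero' (.of_forall fun n => sq_nonneg _) ?_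
      (htop.const_div_atTop (B u u + |C| * ‖u‖ ^ 2))
    filter_upwards [htop.eventually_gt_atTop 0] with n hn
    rw [le_div_iff₀ hn, mul_comm]
    exact hle n
  have hn : Tendsto (fun n => ‖u - partialSum e u n‖) atTop (𝓝 0) := by
    have := hsq.sqrt
    simpa [Real.sqrt_sq] using this
  have := tendsto_zero_iff_norm_tendsto_zero.2 hn
  simpa using this.const_sub u

theorem exists_eigenfamily (hsymm : ∀ u v, B u v = B v u) (hinf : ¬ FiniteDimensional ℝ V)
    (hcpt : FormCompact B) {C : ℝ} (hbdd : ∀ u, -C * ‖u‖ ^ 2 ≤ B u u) :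
    ∃ (lam : ℕ → ℝ) (e : ℕ → V), IsEigenfamily B lam e ∧
      ∀ u, Tendsto (partialSum e u) atTop (𝓝 u) := by
  have hG : ∀ s : Set V, ∃ u, s.Finite →
      u ∈ unitOrthogonal s ∧ ∀ w ∈ unitOrthogonal s, B u u ≤ B w w := fun s => by
    by_cases hs : s.Finite
    · obtain ⟨u, hu, h⟩ := exists_minimizer hinf hcpt hbdd hs
      exact ⟨u, fun _ => ⟨hu, h⟩⟩
    -- A dummy value: `successive` needs a selector defined on every set, but only feeds it finite
    -- ones.
    · exact ⟨0, fun h => absurd h hs⟩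
  choose G hG using hG
  set e := successive G
  set s : ℕ → Set V := fun n => Set.range fun m : Fin n => e m
  have hes : ∀ n, e n = G (s n) := fun n => by
    simp only [e, s]; rw [successive]
  have hmem : ∀ n, e n ∈ unitOrthogonal (s n) := fun n => by
    rw [hes]; exact (hG _ (Set.finite_range _)).1
  have hmin : ∀ n, ∀ w ∈ unitOrthogonal (s n), B (e n) (e n) ≤ B w w := fun n => by
    rw [hes]; exact (hG _ (Set.finite_range _)).2
  have hs : ∀ {n : ℕ} {u : V}, (∀ j < n, inner ℝ (e j) u = 0) → ∀ x ∈ s n, inner ℝ x u = 0 := by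
    rintro n u h _ ⟨m, rfl⟩
    exact h m m.2
  have hlt : ∀ {m n : ℕ}, m < n → inner ℝ (e m) (e n) = 0 := fun {m n} hmn =>
    (hmem n).2 _ ⟨⟨m, hmn⟩, rfl⟩
  have horth : Orthonormal ℝ e := by
    refine ⟨fun n => (hmem n).1, fun m n hmn => ?_⟩
    rcases lt_or_gt_of_ne hmn with h | h
    · exact hlt h
    · rw [real_inner_comm]; exact hlt h
  -- Minimality yields the equation only for v orthogonal to the earlier vectors. Induction removes
  -- the restriction: the earlier vectors are eigenvectors, hence also B-orthogonal to e k.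
  have hweak : ∀ k v, B (e k) v = B (e k) (e k) * inner ℝ (e k) v := by
    intro k
    induction k using Nat.strong_induction_on with
    | _ k ih =>
      intro v
      have h1 := minimizer_weak_eq hsymm (hmem k) (hmin k) (v := v - partialSum e v k)
        (hs fun j hj => inner_sub_partialSum horth v hj)
      have h2 : B (e k) (partialSum e v k) = 0 := by
        rw [partialSum, map_sum]
        refine Finset.sum_eq_zero fun j hj => ?_
        rw [map_smul, hsymm, ih j (Finset.mem_range.1 hj), hlt (Finset.mem_range.1 hj), mul_zero,
          smul_zero]
      have h3 : inner ℝ (e k) (partialSum e v k) = 0 := by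
        rw [partialSum, inner_sum]
        refine Finset.sum_eq_zero fun j hj => ?_
        rw [inner_smul_right, real_inner_comm (e j) (e k), hlt (Finset.mem_range.1 hj), mul_zero]
      rw [map_sub, h2, inner_sub_right, h3, sub_zero, sub_zero] at h1
      exact h1
  have hmono : Monotone fun k => B (e k) (e k) := by
    refine monotone_nat_of_le_succ fun k => hmin k _ (unitOrthogonal_anti ?_ (hmem (k + 1)))
    rintro _ ⟨m, rfl⟩
    exact ⟨⟨m, m.2.trans (Nat.lt_succ_self k)⟩, rfl⟩
  have hfam : IsEigenfamily B (fun k => B (e k) (e k)) e := ⟨hmono, horth, hweak⟩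
  refine ⟨_, e, hfam, hfam.tendsto_partialSum hsymm hbdd ?_ fun u k hu =>
    sublevel_of_minimizer (hmin k) (hs hu)⟩
  -- If the values converged, compactness would extract a convergent subsequence of e, yet
  -- orthonormal vectors stay at squared distance 2.
  refine (tendsto_atTop_of_monotone hmono).resolve_right ?_
  rintro ⟨l, hl⟩
  obtain ⟨w, φ, hφ, hw, -⟩ := hcpt e _ l (fun n => (horth.1 n).le) (fun n => le_rfl) hl
  have h1 : Tendsto (fun n => ‖e (φ (n + 1)) - e (φ n)‖ ^ 2) atTop (𝓝 (‖w - w‖ ^ 2)) :=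
    (((tendsto_add_atTop_iff_nat 1).2 hw).sub hw).norm.pow 2
  have h2 : ∀ n, ‖e (φ (n + 1)) - e (φ n)‖ ^ 2 = 2 := fun n => by
    rw [norm_sub_sq_real, real_inner_comm, hlt (hφ (Nat.lt_succ_self n)), horth.1, horth.1]
    norm_num
  simp only [h2] at h1
  have := tendsto_nhds_unique h1 tendsto_const_nhds
  simp at this

/-- Ky Fan's trace inequality. -/
theorem IsEigenfamily.sum_le_trace {lam : ℕ → ℝ} {e : ℕ → V} (h : IsEigenfamily B lam e)
    (hsymm : ∀ u v, B u v = B v u) {C : ℝ} (hbdd : ∀ u, -C * ‖u‖ ^ 2 ≤ B u u)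
    (hexp : ∀ u, Tendsto (partialSum e u) atTop (𝓝 u)) {k : ℕ} {ψ : Fin k → V}
    (hψ : Orthonormal ℝ ψ) :
    ∑ j ∈ Finset.range k, lam j ≤ ∑ i, B (ψ i) (ψ i) := by
  set ε : ℕ → ℝ := fun n => ∑ i, ‖ψ i - partialSum e (ψ i) n‖ ^ 2
  have hε : Tendsto ε atTop (𝓝 0) := by
    have : Tendsto ε atTop (𝓝 (∑ i : Fin k, ‖ψ i - ψ i‖ ^ 2)) :=
      tendsto_finsetSum _ fun i _ => ((hexp (ψ i)).const_sub (ψ i)).norm.pow 2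
    simpa using this
  -- Up to the tail ε n, the trace is a weighted sum of the lam j with weights in [0, 1] of total
  -- mass k. Such a sum is smallest when the mass fills the k lowest levels; subtracting lam k makes
  -- this a termwise comparison.
  set w : ℕ → ℝ := fun j => ∑ i, inner ℝ (e j) (ψ i) ^ 2
  have hw0 : ∀ j, 0 ≤ w j := fun j => Finset.sum_nonneg fun i _ => sq_nonneg _
  have hw1 : ∀ j, w j ≤ 1 := fun j => by
    have := hψ.sum_inner_products_le (x := e j) (s := Finset.univ)
    simp only [Real.norm_eq_abs, sq_abs, h.orthonormal.1 j] at this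
    simpa only [w, real_inner_comm, one_pow] using this
  have hε' : ∀ n, ε n = k - ∑ j ∈ Finset.range n, w j := fun n => by
    simp only [ε, w, norm_sub_partialSum_sq h.orthonormal, hψ.1, Finset.sum_sub_distrib]
    rw [Finset.sum_comm]; simp
  have hmain : ∀ n ≥ k, ∑ j ∈ Finset.range k, lam j - (lam k + C) * ε n ≤ ∑ i, B (ψ i) (ψ i) := by
    intro n hn
    have h1 : ∑ i, (B (ψ i) (ψ i) - ∑ j ∈ Finset.range n, lam j * inner ℝ (e j) (ψ i) ^ 2)
        ≥ ∑ i, -C * ‖ψ i - partialSum e (ψ i) n‖ ^ 2 :=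
      Finset.sum_le_sum fun i _ => (hbdd _).trans_eq (h.form_sub_partialSum hsymm (ψ i) n)
    rw [← Finset.mul_sum, Finset.sum_sub_distrib, Finset.sum_comm] at h1
    simp only [← Finset.mul_sum] at h1
    change _ - ∑ j ∈ Finset.range n, lam j * w j ≥ -C * ε n at h1
    have h2 : ∑ j ∈ Finset.range k, (lam j - lam k) ≤
        ∑ j ∈ Finset.range n, (lam j - lam k) * w j := by
      rw [← Finset.sum_range_add_sum_Ico _ hn]
      have h3 : 0 ≤ ∑ j ∈ Finset.Ico k n, (lam j - lam k) * w j :=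
        Finset.sum_nonneg fun j hj =>
          mul_nonneg (sub_nonneg.2 (h.mono (Finset.mem_Ico.1 hj).1)) (hw0 j)
      have h4 : ∑ j ∈ Finset.range k, (lam j - lam k) ≤
          ∑ j ∈ Finset.range k, (lam j - lam k) * w j :=
        Finset.sum_le_sum fun j hj => by
          have : lam j - lam k ≤ 0 := sub_nonpos.2 (h.mono (Finset.mem_range.1 hj).le)
          nlinarith [hw1 j]
      linarith
    simp only [sub_mul, Finset.sum_sub_distrib, Finset.sum_const, Finset.card_range, nsmul_eq_mul,
      ← Finset.mul_sum] at h2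
    have h5 := hε' n
    have h6 : ∑ j ∈ Finset.range n, w j = k - ε n := by linarith
    rw [h6] at h2
    linarith
  have hlim : Tendsto (fun n => ∑ j ∈ Finset.range k, lam j - (lam k + C) * ε n) atTop
      (𝓝 (∑ j ∈ Finset.range k, lam j)) := by
    simpa using (hε.const_mul (lam k + C)).const_sub (∑ j ∈ Finset.range k, lam j)
  exact le_of_tendsto hlim (eventually_atTop.2 ⟨k, hmain⟩)

end Abstract

/-- By monotonicity lam k is at least the average of the terms up to k, and at most the average over
the block from k + 1 to 2k + 1. The block sum is a difference of partial sums, and doubling the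
index changes the logarithm only by ln 2. -/
theorem tendsto_div_log_of_sum_bounds {lam : ℕ → ℝ} (hmono : Monotone lam) {a C : ℝ}
    (hlow : ∀ k : ℕ, 1 ≤ k → k * (a * Real.log k - C) ≤ ∑ j ∈ Finset.range k, lam j)
    (hup : ∀ k : ℕ, 1 ≤ k → ∑ j ∈ Finset.range k, lam j ≤ k * (a * Real.log k + C)) :
    Tendsto (fun k : ℕ => lam k / Real.log ((k : ℝ) + 1)) atTop (𝓝 a) := by
  have h1 : ∀ k : ℕ, a * Real.log ((k : ℝ) + 1) - C ≤ lam k := fun k => by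
    have h := hlow (k + 1) (Nat.succ_pos k)
    have h2 : ∑ j ∈ Finset.range (k + 1), lam j ≤ ∑ j ∈ Finset.range (k + 1), lam k :=
      Finset.sum_le_sum fun j hj => hmono (Nat.lt_succ_iff.1 (Finset.mem_range.1 hj))
    rw [Finset.sum_const, Finset.card_range, nsmul_eq_mul] at h2
    push_cast at h h2
    exact le_of_mul_le_mul_left (h.trans h2) (by positivity)
  have h2 : ∀ k : ℕ, lam k ≤ a * Real.log ((k : ℝ) + 1) + (2 * a * Real.log 2 + 3 * C) := fun k => by
    have hu := hup (2 * (k + 1)) (by omega)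
    have hl := hlow (k + 1) (Nat.succ_pos k)
    have h3 : ∑ j ∈ Finset.Ico (k + 1) (2 * (k + 1)), lam k ≤
        ∑ j ∈ Finset.Ico (k + 1) (2 * (k + 1)), lam j :=
      Finset.sum_le_sum fun j hj => hmono (by have := Finset.mem_Ico.1 hj; omega)
    rw [Finset.sum_const, Nat.card_Ico, nsmul_eq_mul,
      show 2 * (k + 1) - (k + 1) = k + 1 by omega] at h3
    have h4 := Finset.sum_range_add_sum_Ico lam (show k + 1 ≤ 2 * (k + 1) by omega)
    have hp : (0 : ℝ) < (k : ℝ) + 1 := by positivity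
    push_cast at hu hl h3
    rw [Real.log_mul two_ne_zero hp.ne'] at hu
    refine le_of_mul_le_mul_left ?_ hp
    nlinarith
  have hlog : Tendsto (fun k : ℕ => Real.log ((k : ℝ) + 1)) atTop atTop :=
    Real.tendsto_log_atTop.comp (tendsto_atTop_add_const_right _ _ tendsto_natCast_atTop_atTop)
  have hl : Tendsto (fun k : ℕ => a - C / Real.log ((k : ℝ) + 1)) atTop (𝓝 a) := by
    simpa using (hlog.const_div_atTop C).const_sub a
  have hu : Tendsto (fun k : ℕ => a + (2 * a * Real.log 2 + 3 * C) / Real.log ((k : ℝ) + 1)) atTop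
      (𝓝 a) := by
    simpa using (hlog.const_div_atTop (2 * a * Real.log 2 + 3 * C)).const_add a
  refine tendsto_of_tendsto_of_tendsto_of_le_of_le' hl hu ?_ ?_
  · filter_upwards [hlog.eventually_gt_atTop 0] with k hk
    rw [le_div_iff₀ hk, sub_mul, div_mul_cancel₀ _ hk.ne']
    exact h1 k
  · filter_upwards [hlog.eventually_gt_atTop 0] with k hk
    rw [div_le_iff₀ hk, add_mul, div_mul_cancel₀ _ hk.ne']
    exact h2 k

variable {N : ℕ}

/-! ### Polar coordinates and the truncated kernel -/

section Radial

/-- The volume of the unit ball of `ℝ^N`. -/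
def ballVol (N : ℕ) : ℝ := volume.real (Metric.ball (0 : EuclideanSpace ℝ (Fin N)) 1)

theorem ballVol_pos : 0 < ballVol N :=
  ENNReal.toReal_pos (Metric.measure_ball_pos _ _ one_pos).ne' measure_ball_lt_top.ne

theorem ballVol_eq (hN : 1 ≤ N) :
    ballVol N = Real.pi ^ ((N : ℝ) / 2) / Real.Gamma ((N : ℝ) / 2 + 1) := by
  have : Nonempty (Fin N) := ⟨⟨0, hN⟩⟩
  rw [ballVol, measureReal_def, EuclideanSpace.volume_ball, Fintype.card_fin, ENNReal.ofReal_one,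
    one_pow, one_mul, ENNReal.toReal_ofReal]
  · rw [Real.sqrt_eq_rpow, ← Real.rpow_natCast, ← Real.rpow_mul Real.pi_pos.le]
    ring_nf
  · have : 0 < Real.Gamma ((N : ℝ) / 2 + 1) := Real.Gamma_pos_of_pos (by positivity)
    positivity

theorem cConst_pos (hN : 1 ≤ N) : 0 < cConst N := by
  have : (0 : ℝ) < N := by exact_mod_cast hN
  have : 0 < Real.Gamma ((N : ℝ) / 2) := Real.Gamma_pos_of_pos (by positivity)
  have := Real.pi_pos
  unfold cConst; positivity

/-- N times the volume of the unit ball is the area of the unit sphere. This normalization is the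
source of the 2 in the limit 2/N. -/
theorem cConst_mul_sphere (hN : 1 ≤ N) : cConst N * (N * ballVol N) = 2 := by
  have hN' : (0 : ℝ) < N := by exact_mod_cast hN
  have hG : 0 < Real.Gamma ((N : ℝ) / 2) := Real.Gamma_pos_of_pos (by positivity)
  rw [ballVol_eq hN, cConst, Real.Gamma_add_one (by positivity), neg_div,
    Real.rpow_neg Real.pi_pos.le]
  have := Real.rpow_pos_of_pos Real.pi_pos ((N : ℝ) / 2)
  field_simp

theorem integrable_radial (hN : 1 ≤ N) {g G : ℝ → ℝ}
    (hG : ∀ y, 0 < y → y ^ (N - 1) * g y = G y) :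
    Integrable (fun x : EuclideanSpace ℝ (Fin N) => g ‖x‖) ↔ IntegrableOn G (Set.Ioi 0) := by
  have : Nontrivial (EuclideanSpace ℝ (Fin N)) :=
    Module.nontrivial_of_finrank_pos (R := ℝ) (by rw [finrank_euclideanSpace_fin]; exact hN)
  rw [integrable_fun_norm_addHaar volume (f := g), finrank_euclideanSpace_fin]
  exact integrableOn_congr_fun (fun y hy => hG y hy) measurableSet_Ioi

theorem integral_radial (hN : 1 ≤ N) {g G : ℝ → ℝ}
    (hG : ∀ y, 0 < y → y ^ (N - 1) * g y = G y) :
    ∫ x : EuclideanSpace ℝ (Fin N), g ‖x‖ = N * ballVol N * ∫ y in Set.Ioi 0, G y := by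
  have : Nontrivial (EuclideanSpace ℝ (Fin N)) :=
    Module.nontrivial_of_finrank_pos (R := ℝ) (by rw [finrank_euclideanSpace_fin]; exact hN)
  rw [integral_fun_norm_addHaar volume g, finrank_euclideanSpace_fin,
    setIntegral_congr_fun (f := fun y => y ^ (N - 1) • g y) measurableSet_Ioi (fun y hy => hG y hy), nsmul_eq_mul,
    smul_eq_mul, mul_assoc, ballVol]

/-- The kernel `|h|^(-N)` truncated to `δ ≤ |h| ≤ 1`. -/
def annKer (N : ℕ) (δ : ℝ) (h : EuclideanSpace ℝ (Fin N)) : ℝ :=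
  (Set.Icc δ 1).indicator (fun r => (r ^ N)⁻¹) ‖h‖

theorem annKer_nonneg {δ : ℝ} (h : EuclideanSpace ℝ (Fin N)) : 0 ≤ annKer N δ h :=
  Set.indicator_apply_nonneg fun hh => by positivity

theorem annKer_neg {δ : ℝ} (h : EuclideanSpace ℝ (Fin N)) : annKer N δ (-h) = annKer N δ h := by
  simp [annKer]

theorem measurable_annKer (N : ℕ) (δ : ℝ) : Measurable (annKer N δ) :=
  (Measurable.indicator (by fun_prop) measurableSet_Icc).comp measurable_norm

theorem pow_pred_mul_inv (hN : 1 ≤ N) {y : ℝ} (hy : 0 < y) : y ^ (N - 1) * (y ^ N)⁻¹ = y⁻¹ := by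
  obtain ⟨n, rfl⟩ : ∃ n, N = n + 1 := ⟨N - 1, by omega⟩
  rw [Nat.add_sub_cancel, pow_succ]; field_simp

theorem annKer_radial (hN : 1 ≤ N) (δ : ℝ) (y : ℝ) (hy : 0 < y) :
    y ^ (N - 1) * (Set.Icc δ 1).indicator (fun r => (r ^ N)⁻¹) y =
      (Set.Icc δ 1).indicator (fun r => r⁻¹) y := by
  unfold Set.indicator
  split_ifs
  · exact pow_pred_mul_inv hN hy
  · simp

theorem annKer_sq_radial (hN : 1 ≤ N) (δ : ℝ) (y : ℝ) (hy : 0 < y) :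
    y ^ (N - 1) * ((Set.Icc δ 1).indicator (fun r => (r ^ N)⁻¹) y) ^ 2 =
      (Set.Icc δ 1).indicator (fun r => r ^ (-(N + 1 : ℤ))) y := by
  unfold Set.indicator
  split_ifs
  · beta_reduce
    rw [sq, ← mul_assoc, pow_pred_mul_inv hN hy, zpow_neg, zpow_add_one₀ hy.ne', zpow_natCast,
      mul_inv, mul_comm]
  · simp

theorem setIntegral_Ioi_indicator_Icc {δ : ℝ} (h0 : 0 < δ) (h1 : δ ≤ 1) (f : ℝ → ℝ) :
    ∫ y in Set.Ioi (0 : ℝ), (Set.Icc δ 1).indicator f y = ∫ y in δ..1, f y := by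
  rw [setIntegral_indicator measurableSet_Icc, Set.inter_eq_self_of_subset_right
    (s := Set.Ioi (0 : ℝ)) (fun y hy => h0.trans_le hy.1), integral_Icc_eq_integral_Ioc,
    intervalIntegral.integral_of_le h1]

theorem integrableOn_Ioi_indicator_Icc {δ : ℝ} {f : ℝ → ℝ}
    (hf : ContinuousOn f (Set.Icc δ 1)) :
    IntegrableOn ((Set.Icc δ 1).indicator f) (Set.Ioi 0) :=
  ((hf.integrableOn_compact isCompact_Icc).integrable_indicator measurableSet_Icc).integrableOn

theorem integrable_annKer (hN : 1 ≤ N) {δ : ℝ} (h0 : 0 < δ) : Integrable (annKer N δ) := by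
  refine (integrable_radial hN (annKer_radial hN δ)).2 (integrableOn_Ioi_indicator_Icc ?_)
  exact continuousOn_inv₀.mono fun y hy => (h0.trans_le hy.1).ne'

theorem integrable_annKer_sq (hN : 1 ≤ N) {δ : ℝ} (h0 : 0 < δ) :
    Integrable (fun h => annKer N δ h ^ 2) := by
  refine (integrable_radial hN (annKer_sq_radial hN δ)).2 (integrableOn_Ioi_indicator_Icc ?_)
  exact (continuousOn_zpow₀ _).mono fun y hy => (h0.trans_le hy.1).ne'

theorem integral_annKer (hN : 1 ≤ N) {δ : ℝ} (h0 : 0 < δ) (h1 : δ ≤ 1) :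
    cConst N * ∫ h, annKer N δ h = 2 * Real.log δ⁻¹ := by
  have := integral_radial hN (annKer_radial hN δ)
  unfold annKer
  rw [this, setIntegral_Ioi_indicator_Icc h0 h1, ← mul_assoc, cConst_mul_sphere hN,
    integral_inv_of_pos h0 one_pos, one_div]

/-- In polar coordinates the integrand is r^(-N-1), with integral (δ^(-N) - 1)/N. The power δ^(-N)
dictates the scale δ = k^(-1/N) in the trace bound. -/
theorem integral_annKer_sq_le (hN : 1 ≤ N) {δ : ℝ} (h0 : 0 < δ) (h1 : δ ≤ 1) :
    ∫ h, annKer N δ h ^ 2 ≤ ballVol N * (δ ^ N)⁻¹ := by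
  have hN' : (0 : ℝ) < N := by exact_mod_cast hN
  have := integral_radial hN (annKer_sq_radial hN δ)
  unfold annKer
  rw [this, setIntegral_Ioi_indicator_Icc h0 h1, integral_zpow]
  · rw [show (-(N + 1 : ℤ) + 1) = -(N : ℤ) by ring, one_zpow, zpow_neg, zpow_natCast]
    push_cast
    have h2 : (1 - (δ ^ N)⁻¹) / (-((N : ℝ) + 1) + 1) = ((δ ^ N)⁻¹ - 1) / N := by
      rw [show -((N : ℝ) + 1) + 1 = -N by ring, div_neg, ← neg_div, neg_sub]
    rw [h2, mul_comm (N : ℝ), mul_assoc, mul_div_cancel₀ _ hN'.ne']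
    have := ballVol_pos (N := N)
    gcongr; linarith
  · refine Or.inr ⟨by omega, ?_⟩
    rw [Set.uIcc_of_le h1]
    exact fun h => absurd h.1 (not_le.2 h0)

end Radial

/-! ### Double integrals of convolution type -/

section Convolution

theorem integrable_conv_snd {a k : EuclideanSpace ℝ (Fin N) → ℝ} (ha : Integrable a)
    (hk : Integrable k) :
    Integrable (fun p : EuclideanSpace ℝ (Fin N) × EuclideanSpace ℝ (Fin N) =>
      a p.2 * k (p.1 - p.2)) :=
  Integrable.convolution_integrand (ContinuousLinearMap.mul ℝ ℝ) ha hk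

theorem integral_conv_snd {a k : EuclideanSpace ℝ (Fin N) → ℝ} (ha : Integrable a)
    (hk : Integrable k) :
    ∫ p : EuclideanSpace ℝ (Fin N) × EuclideanSpace ℝ (Fin N), a p.2 * k (p.1 - p.2) =
      (∫ x, a x) * ∫ x, k x := by
  have h := integral_convolution (ContinuousLinearMap.mul ℝ ℝ) ha hk
  have h2 := integral_prod _ (integrable_conv_snd ha hk)
  rw [← Measure.volume_eq_prod] at h2
  rw [h2]
  simpa [convolution] using h

theorem integrable_conv_fst {a k : EuclideanSpace ℝ (Fin N) → ℝ} (ha : Integrable a)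
    (hk : Integrable k) (hkn : ∀ x, k (-x) = k x) :
    Integrable (fun p : EuclideanSpace ℝ (Fin N) × EuclideanSpace ℝ (Fin N) =>
      a p.1 * k (p.1 - p.2)) := by
  have := (integrable_conv_snd ha hk).swap
  refine this.congr (.of_forall fun p => ?_)
  simp [← hkn (p.1 - p.2)]

theorem integral_conv_fst {a k : EuclideanSpace ℝ (Fin N) → ℝ} (ha : Integrable a)
    (hk : Integrable k) (hkn : ∀ x, k (-x) = k x) :
    ∫ p : EuclideanSpace ℝ (Fin N) × EuclideanSpace ℝ (Fin N), a p.1 * k (p.1 - p.2) =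
      (∫ x, a x) * ∫ x, k x := by
  rw [← integral_conv_snd ha hk, Measure.volume_eq_prod, ← integral_prod_swap]
  refine integral_congr_ae (.of_forall fun p => ?_)
  simp [← hkn (p.1 - p.2)]

end Convolution

/-! ### The form domain and its square integrability -/

section FormDomain

variable {Ω : Set (EuclideanSpace ℝ (Fin N))} {u v w : EuclideanSpace ℝ (Fin N) → ℝ}

theorem measurableSet_nearSet : MeasurableSet (nearSet N) :=
  measurableSet_le (by fun_prop) measurable_const

theorem measurableSet_farSet : MeasurableSet (farSet N) :=
  measurableSet_le measurable_const (by fun_prop)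

theorem ae_comp_fst (h : u =ᵐ[volume] v) :
    ∀ᵐ p : EuclideanSpace ℝ (Fin N) × EuclideanSpace ℝ (Fin N), u p.1 = v p.1 :=
  Measure.quasiMeasurePreserving_fst.ae h

theorem ae_comp_snd (h : u =ᵐ[volume] v) :
    ∀ᵐ p : EuclideanSpace ℝ (Fin N) × EuclideanSpace ℝ (Fin N), u p.2 = v p.2 :=
  Measure.quasiMeasurePreserving_snd.ae h

theorem aemeasurable_sub_comp (h : AEMeasurable u) :
    AEMeasurable (fun p : EuclideanSpace ℝ (Fin N) × EuclideanSpace ℝ (Fin N) => u p.1 - u p.2) :=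
  (h.comp_quasiMeasurePreserving Measure.quasiMeasurePreserving_fst).sub
    (h.comp_quasiMeasurePreserving Measure.quasiMeasurePreserving_snd)

theorem measurable_norm_sub_pow :
    Measurable (fun p : EuclideanSpace ℝ (Fin N) × EuclideanSpace ℝ (Fin N) =>
      ‖p.1 - p.2‖ ^ N) := by fun_prop

theorem MemH.congr (h : MemH Ω u) (huv : u =ᵐ[volume] v) (hv : ∀ x, x ∉ Ω → v x = 0) :
    MemH Ω v where
  aemeasurable := h.aemeasurable.congr huv
  eq_zero := hv
  integrableOn := by
    refine Integrable.congr h.integrableOn (ae_restrict_of_ae ?_)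
    filter_upwards [ae_comp_fst huv, ae_comp_snd huv] with p h1 h2
    rw [h1, h2]

theorem MemH.zero : MemH Ω (0 : EuclideanSpace ℝ (Fin N) → ℝ) where
  aemeasurable := aemeasurable_const
  eq_zero := fun _ _ => rfl
  integrableOn := by simp [IntegrableOn]

theorem MemH.const_smul (h : MemH Ω u) (c : ℝ) : MemH Ω (c • u) where
  aemeasurable := h.aemeasurable.const_smul c
  eq_zero := fun x hx => by simp [h.eq_zero x hx]
  integrableOn := by
    refine (h.integrableOn.const_mul (c ^ 2)).congr (.of_forall fun p => ?_)
    simp only [Pi.smul_apply, smul_eq_mul]; ring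

theorem MemH.integrableOn_mul (hu : MemH Ω u) (hw : MemH Ω w) :
    IntegrableOn (fun p : EuclideanSpace ℝ (Fin N) × EuclideanSpace ℝ (Fin N) =>
      (u p.1 - u p.2) * (w p.1 - w p.2) / ‖p.1 - p.2‖ ^ N) (nearSet N) := by
  refine Integrable.mono' (hu.integrableOn.add hw.integrableOn) ?_ (.of_forall fun p => ?_)
  · exact (((aemeasurable_sub_comp hu.aemeasurable).mul
      (aemeasurable_sub_comp hw.aemeasurable)).div
      measurable_norm_sub_pow.aemeasurable).aestronglyMeasurable.restrict
  · have h0 : 0 ≤ ‖p.1 - p.2‖ ^ N := by positivity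
    rw [Real.norm_eq_abs, abs_div, abs_of_nonneg h0, Pi.add_apply, ← add_div]
    refine div_le_div_of_nonneg_right ?_ h0
    rw [abs_le]
    constructor <;> nlinarith [sq_nonneg ((u p.1 - u p.2) - (w p.1 - w p.2)),
      sq_nonneg ((u p.1 - u p.2) + (w p.1 - w p.2)), sq_nonneg (u p.1 - u p.2),
      sq_nonneg (w p.1 - w p.2)]

theorem MemH.add (hu : MemH Ω u) (hw : MemH Ω w) : MemH Ω (u + w) where
  aemeasurable := hu.aemeasurable.add hw.aemeasurable
  eq_zero := fun x hx => by simp [hu.eq_zero x hx, hw.eq_zero x hx]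
  integrableOn := by
    refine ((hu.integrableOn.add hw.integrableOn).add ((hu.integrableOn_mul hw).const_mul 2)).congr
      (.of_forall fun p => ?_)
    simp only [Pi.add_apply]; ring

/-- Functions in the form domain are square integrable. -/
theorem MemH.memLp (hN : 1 ≤ N) (hΩ : MeasurableSet Ω) (hbdd : Bornology.IsBounded Ω)
    (hu : MemH Ω u) : MemLp u 2 := by
  have : Nontrivial (EuclideanSpace ℝ (Fin N)) :=
    Module.nontrivial_of_finrank_pos (R := ℝ) (by rw [finrank_euclideanSpace_fin]; exact hN)
  obtain ⟨R, hR⟩ := hbdd.subset_closedBall 0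
  have h1 := (integrable_indicator_iff measurableSet_nearSet).2 hu.integrableOn
  -- After the shear (x, h) ↦ (x, x + h), Fubini makes x ↦ u x - u (x + h) square integrable for
  -- almost every h with |h| < 1. Fix one with |h| > 1/2: telescoping over multiples of h then
  -- reaches a translate at which u vanishes.
  have h2 := (measurePreserving_prod_add (volume : Measure (EuclideanSpace ℝ (Fin N)))
    (volume : Measure (EuclideanSpace ℝ (Fin N)))).integrable_comp_of_integrable h1
  have h3 := h2.prod_left_ae
  obtain ⟨h, hh, hmem⟩ := (Measure.dense_of_ae h3).exists_mem_open
    (U := {h : EuclideanSpace ℝ (Fin N) | 1 / 2 < ‖h‖ ∧ ‖h‖ < 1})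
    ((isOpen_lt continuous_const continuous_norm).inter
      (isOpen_lt continuous_norm continuous_const)) (by
        obtain ⟨x, hx⟩ := exists_norm_eq (EuclideanSpace ℝ (Fin N)) (c := 3 / 4) (by norm_num)
        exact ⟨x, by rw [Set.mem_ofPred_eq, hx]; norm_num⟩)
  have hpos : 0 < ‖h‖ := by linarith [hmem.1]
  have hd : MemLp (fun x => u x - u (x + h)) 2 := by
    have hm : AEMeasurable (fun x => u x - u (x + h)) :=
      hu.aemeasurable.sub (hu.aemeasurable.comp_quasiMeasurePreserving
        (measurePreserving_add_right volume h).quasiMeasurePreserving)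
    rw [memLp_two_iff_integrable_sq hm.aestronglyMeasurable]
    refine (Integrable.mul_const hh (‖h‖ ^ N)).congr (.of_forall fun x => ?_)
    have : (x, x + h) ∈ nearSet N := by simpa [nearSet] using hmem.2.le
    simp only [Function.comp_apply, Set.indicator_of_mem this, sub_add_cancel_left, norm_neg]
    field_simp
  have hsum : ∀ M : ℕ, MemLp (fun x => u x - u (x + M • h)) 2 := fun M => by
    induction M with
    | zero => simp
    | succ M ih =>
      refine (ih.add (hd.comp_measurePreserving (measurePreserving_add_right volume (M • h)))).ae_eq
        (.of_forall fun x => ?_)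
      simp only [Pi.add_apply, Function.comp_apply, succ_nsmul, add_assoc]; ring
  -- Now |M • h| > 2R, so x + M • h lies outside Ω for every x in Ω.
  obtain ⟨M, hM⟩ := exists_nat_gt (4 * R)
  refine ((hsum M).indicator hΩ).ae_eq (.of_forall fun x => ?_)
  by_cases hx : x ∈ Ω
  · rw [Set.indicator_of_mem hx, hu.eq_zero (x + M • h), sub_zero]
    intro hmem2
    have ha := mem_closedBall_zero_iff.1 (hR hmem2)
    have hb := mem_closedBall_zero_iff.1 (hR hx)
    have hc : ‖M • h‖ = M * ‖h‖ := by rw [← Nat.cast_smul_eq_nsmul ℝ, norm_smul]; simp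
    have hd : ‖M • h‖ ≤ ‖x + M • h‖ + ‖x‖ := by
      have := norm_sub_le (x + M • h) x
      rwa [add_sub_cancel_left] at this
    nlinarith [hmem.1, (Nat.cast_nonneg M : (0 : ℝ) ≤ M)]
  · rw [Set.indicator_of_notMem hx, hu.eq_zero x hx]

end FormDomain

/-! ### Upper bounds for the lower-order part, lower bounds for the leading part -/

section Bounds

variable {Ω : Set (EuclideanSpace ℝ (Fin N))} {u v w : EuclideanSpace ℝ (Fin N) → ℝ}

theorem integrable_of_memLp (hbdd : Bornology.IsBounded Ω)
    (hu : MemLp u 2) (hu0 : ∀ x, x ∉ Ω → u x = 0) : Integrable u := by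
  have : IsFiniteMeasure (volume.restrict Ω) := ⟨by
    rw [Measure.restrict_apply_univ]; exact hbdd.measure_lt_top⟩
  have h := (hu.restrict Ω).integrable one_le_two
  exact (integrableOn_iff_integrable_of_support_subset fun x hx => by
    by_contra h; exact hx (hu0 x h)).1 h

theorem integral_abs_le (hΩ : MeasurableSet Ω) (hbdd : Bornology.IsBounded Ω)
    (hu : MemLp u 2) (hu0 : ∀ x, x ∉ Ω → u x = 0) :
    ∫ x, |u x| ≤ √(volume.real Ω) * √(∫ x, u x ^ 2) := by
  have hi : MemLp (Ω.indicator (fun _ => (1 : ℝ))) (ENNReal.ofReal 2) :=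
    memLp_indicator_const _ hΩ 1 (Or.inr hbdd.measure_lt_top.ne)
  have h := integral_mul_norm_le_Lp_mul_Lq (μ := volume) (f := Ω.indicator (fun _ => (1 : ℝ)))
    (g := u) Real.HolderConjugate.two_two hi (by simpa using hu)
  have h1 : ∀ x, ‖Ω.indicator (fun _ => (1 : ℝ)) x‖ * ‖u x‖ = |u x| := fun x => by
    by_cases hx : x ∈ Ω <;> simp [hx, hu0]
  have h2 : ∀ x, ‖Ω.indicator (fun _ => (1 : ℝ)) x‖ ^ (2 : ℝ) = Ω.indicator (fun _ => (1 : ℝ)) x :=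
    fun x => by by_cases hx : x ∈ Ω <;> simp [hx]
  simp only [h1, h2] at h
  simp only [Real.norm_eq_abs, Real.rpow_two, sq_abs] at h
  rwa [integral_indicator_const _ hΩ, smul_eq_mul, mul_one, ← Real.sqrt_eq_rpow,
    ← Real.sqrt_eq_rpow] at h

theorem far_integrable (hu : Integrable u) (hw : Integrable w) :
    IntegrableOn (fun p : EuclideanSpace ℝ (Fin N) × EuclideanSpace ℝ (Fin N) =>
      u p.1 * w p.2 / ‖p.1 - p.2‖ ^ N) (farSet N) := by
  refine Integrable.mono (hu.mul_prod hw).integrableOn ?_ ?_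
  · exact ((hu.mul_prod hw).aestronglyMeasurable.aemeasurable.div
      measurable_norm_sub_pow.aemeasurable).aestronglyMeasurable.restrict
  · refine (ae_restrict_iff' measurableSet_farSet).2 (.of_forall fun p hp => ?_)
    rw [norm_div]
    refine div_le_self (norm_nonneg _) ?_
    rw [norm_pow, norm_norm]
    exact one_le_pow₀ hp

theorem abs_far_le (hu : Integrable u) (hw : Integrable w) :
    |∫ p in farSet N, u p.1 * w p.2 / ‖p.1 - p.2‖ ^ N| ≤ (∫ x, |u x|) * ∫ x, |w x| := by
  rw [← integral_prod_mul (fun x => |u x|) (fun x => |w x|)]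
  have hi : Integrable (fun p : EuclideanSpace ℝ (Fin N) × EuclideanSpace ℝ (Fin N) =>
    |u p.1| * |w p.2|) := hu.abs.mul_prod hw.abs
  refine (abs_integral_le_integral_abs).trans ?_
  refine (setIntegral_mono_on (far_integrable hu hw).abs hi.integrableOn measurableSet_farSet
    fun p hp => ?_).trans (setIntegral_le_integral hi (.of_forall fun p => by positivity))
  rw [abs_div, abs_mul]
  refine div_le_self (by positivity) ?_
  rw [abs_of_nonneg (by positivity)]
  exact one_le_pow₀ hp

theorem innerForm_self_nonneg (hN : 1 ≤ N) : 0 ≤ innerForm u u := by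
  have := cConst_pos hN
  unfold innerForm
  refine mul_nonneg (by positivity) (integral_nonneg fun p => ?_)
  exact div_nonneg (mul_self_nonneg _) (by positivity)

theorem integrable_mul_annKer (hN : 1 ≤ N) {δ : ℝ} (h0 : 0 < δ) (hu : MemLp u 2) :
    Integrable (fun p : EuclideanSpace ℝ (Fin N) × EuclideanSpace ℝ (Fin N) =>
      u p.1 * u p.2 * annKer N δ (p.1 - p.2)) := by
  have hk := integrable_annKer hN h0
  refine Integrable.mono' ((integrable_conv_fst hu.integrable_sq hk fun x => annKer_neg x).add
    (integrable_conv_snd hu.integrable_sq hk)) ?_ (.of_forall fun p => ?_)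
  · have hm := hu.aestronglyMeasurable.aemeasurable
    exact (((hm.comp_quasiMeasurePreserving Measure.quasiMeasurePreserving_fst).mul
      (hm.comp_quasiMeasurePreserving Measure.quasiMeasurePreserving_snd)).mul
      ((measurable_annKer N δ).comp (measurable_fst.sub measurable_snd)).aemeasurable
      ).aestronglyMeasurable
  · have hk0 : 0 ≤ annKer N δ (p.1 - p.2) := annKer_nonneg _
    rw [Real.norm_eq_abs, abs_mul, abs_of_nonneg hk0, Pi.add_apply, ← add_mul]
    refine mul_le_mul_of_nonneg_right ?_ hk0
    rw [abs_le]
    constructor <;> nlinarith [sq_nonneg (u p.1 - u p.2), sq_nonneg (u p.1 + u p.2),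
      sq_nonneg (u p.1), sq_nonneg (u p.2)]

/-- The part of the form coming from distances at least `δ` bounds the form from below. -/
theorem innerForm_self_ge (hN : 1 ≤ N) {δ : ℝ} (h0 : 0 < δ) (h1 : δ ≤ 1) (hu : MemH Ω u)
    (hu2 : MemLp u 2) :
    2 * Real.log δ⁻¹ * (∫ x, u x ^ 2) -
        cConst N * ∫ p : EuclideanSpace ℝ (Fin N) × EuclideanSpace ℝ (Fin N),
          u p.1 * u p.2 * annKer N δ (p.1 - p.2) ≤ innerForm u u := by
  have hk := integrable_annKer hN h0
  have hc := cConst_pos hN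
  have i1 := integrable_conv_fst hu2.integrable_sq hk fun x => annKer_neg x
  have i2 := integrable_conv_snd hu2.integrable_sq hk
  have i3 := integrable_mul_annKer hN h0 hu2
  have hexp : ∫ p : EuclideanSpace ℝ (Fin N) × EuclideanSpace ℝ (Fin N),
      (u p.1 - u p.2) ^ 2 * annKer N δ (p.1 - p.2) =
      2 * ((∫ x, u x ^ 2) * ∫ h, annKer N δ h) -
      2 * ∫ p : EuclideanSpace ℝ (Fin N) × EuclideanSpace ℝ (Fin N),
        u p.1 * u p.2 * annKer N δ (p.1 - p.2) := by
    rw [two_mul]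
    conv_rhs =>
      enter [1, 1]
      rw [← integral_conv_fst hu2.integrable_sq hk fun x => annKer_neg x]
    conv_rhs =>
      enter [1, 2]
      rw [← integral_conv_snd hu2.integrable_sq hk]
    rw [← integral_add i1 i2, ← integral_const_mul]
    refine Eq.trans ?_ (integral_sub (i1.add i2) (i3.const_mul 2))
    refine integral_congr_ae (.of_forall fun p => ?_)
    ring
  -- The integrand is nonnegative, so the distances below δ may be dropped.
  have hle : ∫ p : EuclideanSpace ℝ (Fin N) × EuclideanSpace ℝ (Fin N),
      (u p.1 - u p.2) ^ 2 * annKer N δ (p.1 - p.2) ≤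
      ∫ p in nearSet N, (u p.1 - u p.2) * (u p.1 - u p.2) / ‖p.1 - p.2‖ ^ N := by
    rw [← integral_indicator measurableSet_nearSet]
    refine integral_mono_of_nonneg (.of_forall fun p => mul_nonneg (sq_nonneg _) (annKer_nonneg _))
      ((integrable_indicator_iff measurableSet_nearSet).2 (hu.integrableOn_mul hu))
      (.of_forall fun p => ?_)
    beta_reduce
    by_cases hp : ‖p.1 - p.2‖ ∈ Set.Icc δ 1
    · rw [annKer, Set.indicator_of_mem hp, Set.indicator_of_mem (show p ∈ nearSet N from hp.2),
        sq, div_eq_mul_inv]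
    · rw [annKer, Set.indicator_of_notMem hp, mul_zero]
      exact Set.indicator_apply_nonneg fun _ => div_nonneg (mul_self_nonneg _) (by positivity)
  rw [hexp] at hle
  have h3 := mul_le_mul_of_nonneg_left hle (half_pos hc).le
  have h4 := integral_annKer hN h0 h1
  unfold innerForm
  refine le_trans (le_of_eq ?_) h3
  rw [← h4]; ring

/-- A bound for the lower-order terms of the form. -/
def lowerConst (N : ℕ) (Ω : Set (EuclideanSpace ℝ (Fin N))) : ℝ :=
  cConst N * volume.real Ω + |rhoConst N|

/-- The lower-order part of the form. -/
def lowerForm (u w : EuclideanSpace ℝ (Fin N) → ℝ) : ℝ :=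
  rhoConst N * (∫ x, u x * w x) - cConst N * ∫ p in farSet N, u p.1 * w p.2 / ‖p.1 - p.2‖ ^ N

theorem logForm_eq : logForm u w = innerForm u w + lowerForm u w := by
  unfold logForm lowerForm; ring

/-- The far kernel is at most 1, so the far term is controlled by L¹ norms, and on a set of finite
measure these are controlled by L² norms. -/
theorem abs_lowerForm_le (hN : 1 ≤ N) (hΩ : MeasurableSet Ω) (hbdd : Bornology.IsBounded Ω)
    (hu : MemLp u 2) (hu0 : ∀ x, x ∉ Ω → u x = 0) (hw : MemLp w 2) (hw0 : ∀ x, x ∉ Ω → w x = 0) :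
    |lowerForm u w| ≤ lowerConst N Ω * (√(∫ x, u x ^ 2) * √(∫ x, w x ^ 2)) := by
  have hc := cConst_pos hN
  have h1 : |∫ x, u x * w x| ≤ √(∫ x, u x ^ 2) * √(∫ x, w x ^ 2) := by
    have h := integral_mul_norm_le_Lp_mul_Lq (μ := volume) (f := u) (g := w)
      Real.HolderConjugate.two_two (by simpa using hu) (by simpa using hw)
    simp only [Real.norm_eq_abs, Real.rpow_two, sq_abs, ← Real.sqrt_eq_rpow, ← abs_mul] at h
    exact (abs_integral_le_integral_abs).trans h
  have h2 := abs_far_le (integrable_of_memLp hbdd hu hu0) (integrable_of_memLp hbdd hw hw0)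
  have h3 := mul_le_mul (integral_abs_le hΩ hbdd hu hu0) (integral_abs_le hΩ hbdd hw hw0)
    (integral_nonneg fun _ => abs_nonneg _) (by positivity)
  have h4 : √(volume.real Ω) * √(∫ x, u x ^ 2) * (√(volume.real Ω) * √(∫ x, w x ^ 2)) =
      volume.real Ω * (√(∫ x, u x ^ 2) * √(∫ x, w x ^ 2)) := by
    rw [mul_mul_mul_comm, Real.mul_self_sqrt measureReal_nonneg]
  rw [h4] at h3
  unfold lowerForm lowerConst
  refine (abs_sub _ _).trans ?_
  rw [abs_mul, abs_mul, abs_of_pos hc, add_mul, add_comm, mul_assoc (cConst N)]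
  exact add_le_add (mul_le_mul_of_nonneg_left (h2.trans h3) hc.le)
    (mul_le_mul_of_nonneg_left h1 (abs_nonneg _))

theorem abs_lowerForm_self_le (hN : 1 ≤ N) (hΩ : MeasurableSet Ω) (hbdd : Bornology.IsBounded Ω)
    (hu : MemLp u 2) (hu0 : ∀ x, x ∉ Ω → u x = 0) :
    |lowerForm u u| ≤ lowerConst N Ω * ∫ x, u x ^ 2 := by
  have h := abs_lowerForm_le hN hΩ hbdd hu hu0 hu hu0
  rwa [Real.mul_self_sqrt (integral_nonneg fun _ => sq_nonneg _)] at h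

end Bounds

/-! ### Symmetry, bilinearity and invariance under a.e. equality -/

section Bilinear

variable {Ω : Set (EuclideanSpace ℝ (Fin N))} {u u' v w : EuclideanSpace ℝ (Fin N) → ℝ}

theorem far_comm : ∫ p in farSet N, u p.1 * w p.2 / ‖p.1 - p.2‖ ^ N =
    ∫ p in farSet N, w p.1 * u p.2 / ‖p.1 - p.2‖ ^ N := by
  rw [← integral_indicator measurableSet_farSet, ← integral_indicator measurableSet_farSet,
    Measure.volume_eq_prod, ← integral_prod_swap]
  refine integral_congr_ae (.of_forall fun p => ?_)
  have : p.swap ∈ farSet N ↔ p ∈ farSet N := by simp [farSet, norm_sub_rev]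
  by_cases hp : p ∈ farSet N
  · simp [hp, this.2 hp, norm_sub_rev, mul_comm]
  · simp [hp, mt this.1 hp]

theorem lowerForm_comm : lowerForm u w = lowerForm w u := by
  unfold lowerForm
  rw [far_comm]
  simp only [mul_comm]

theorem logForm_comm : logForm u w = logForm w u := by
  rw [logForm_eq, logForm_eq, lowerForm_comm]
  unfold innerForm
  simp only [mul_comm]

theorem lowerForm_add_left (hu : Integrable u) (hu' : Integrable u') (hw : Integrable w)
    (hu2 : MemLp u 2) (hu2' : MemLp u' 2) (hw2 : MemLp w 2) :
    lowerForm (u + u') w = lowerForm u w + lowerForm u' w := by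
  have h1 := integral_add (far_integrable hu hw) (far_integrable hu' hw)
  have h2 := integral_add (hu2.integrable_mul hw2) (hu2'.integrable_mul hw2)
  simp only [← add_div, ← add_mul, Pi.mul_apply] at h1 h2
  simp only [lowerForm, Pi.add_apply, h1, h2]
  ring

theorem logForm_add_left (hN : 1 ≤ N) (hΩ : MeasurableSet Ω) (hbdd : Bornology.IsBounded Ω)
    (hu : MemH Ω u) (hu' : MemH Ω u') (hw : MemH Ω w) :
    logForm (u + u') w = logForm u w + logForm u' w := by
  have h := integral_add (hu.integrableOn_mul hw) (hu'.integrableOn_mul hw)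
  have i : ∀ {v}, MemH Ω v → Integrable v := fun hv =>
    integrable_of_memLp hbdd (hv.memLp hN hΩ hbdd) hv.eq_zero
  have m : ∀ {v}, MemH Ω v → MemLp v 2 := fun hv => hv.memLp hN hΩ hbdd
  rw [logForm_eq, logForm_eq, logForm_eq, lowerForm_add_left (i hu) (i hu') (i hw) (m hu) (m hu')
    (m hw)]
  simp only [← add_div, ← add_mul] at h
  have h' : innerForm (u + u') w = innerForm u w + innerForm u' w := by
    unfold innerForm
    rw [← mul_add, ← h]
    simp only [Pi.add_apply]
    congr 2; ext p; ring
  rw [h']; ring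

theorem lowerForm_smul_left (c : ℝ) : lowerForm (c • u) w = c * lowerForm u w := by
  have h : ∀ p : EuclideanSpace ℝ (Fin N) × EuclideanSpace ℝ (Fin N),
      c * u p.1 * w p.2 / ‖p.1 - p.2‖ ^ N = c * (u p.1 * w p.2 / ‖p.1 - p.2‖ ^ N) :=
    fun p => by ring
  simp only [lowerForm, Pi.smul_apply, smul_eq_mul, h, integral_const_mul]
  simp only [mul_assoc c, integral_const_mul]
  ring

theorem logForm_smul_left (c : ℝ) : logForm (c • u) w = c * logForm u w := by
  have h : ∀ p : EuclideanSpace ℝ (Fin N) × EuclideanSpace ℝ (Fin N),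
      (c * u p.1 - c * u p.2) * (w p.1 - w p.2) / ‖p.1 - p.2‖ ^ N =
      c * ((u p.1 - u p.2) * (w p.1 - w p.2) / ‖p.1 - p.2‖ ^ N) := fun p => by ring
  rw [logForm_eq, logForm_eq, lowerForm_smul_left]
  simp only [innerForm, Pi.smul_apply, smul_eq_mul, h, integral_const_mul]
  ring

theorem lowerForm_congr_left (h : u =ᵐ[volume] u') : lowerForm u w = lowerForm u' w := by
  unfold lowerForm
  congr 2
  · refine integral_congr_ae ?_
    filter_upwards [h] with x hx
    rw [hx]
  · refine integral_congr_ae (ae_restrict_of_ae ?_)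
    filter_upwards [ae_comp_fst h] with p h1
    rw [h1]

theorem logForm_congr_left (h : u =ᵐ[volume] u') : logForm u w = logForm u' w := by
  rw [logForm_eq, logForm_eq, lowerForm_congr_left h]
  congr 1
  unfold innerForm
  congr 1
  refine integral_congr_ae (ae_restrict_of_ae ?_)
  filter_upwards [ae_comp_fst h, ae_comp_snd h] with p h1 h2
  rw [h1, h2]

theorem logForm_congr_right (h : u =ᵐ[volume] u') : logForm w u = logForm w u' := by
  rw [logForm_comm, logForm_congr_left h, logForm_comm]

end Bilinear

/-! ### Transfer of the form to L²(Ω) -/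

section Ltwo

variable {Ω : Set (EuclideanSpace ℝ (Fin N))}

/-- The Hilbert space `L²(Ω)`. -/
abbrev LTwo (Ω : Set (EuclideanSpace ℝ (Fin N))) : Type :=
  Lp ℝ 2 ((volume : Measure (EuclideanSpace ℝ (Fin N))).restrict Ω)

/-- Extension by zero of an element of `L²(Ω)`. -/
def zeroExt (f : LTwo Ω) : EuclideanSpace ℝ (Fin N) → ℝ := Ω.indicator f

theorem zeroExt_of_notMem (f : LTwo Ω) (x : EuclideanSpace ℝ (Fin N)) (hx : x ∉ Ω) :
    zeroExt f x = 0 := Set.indicator_of_notMem hx _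

theorem zeroExt_memLp (hΩ : MeasurableSet Ω) (f : LTwo Ω) : MemLp (zeroExt f) 2 :=
  (memLp_indicator_iff_restrict hΩ).2 (Lp.memLp f)

theorem zeroExt_ae (hΩ : MeasurableSet Ω) {f : LTwo Ω} {u : EuclideanSpace ℝ (Fin N) → ℝ}
    (h : f =ᵐ[volume.restrict Ω] u) (hu : ∀ x, x ∉ Ω → u x = 0) : zeroExt f =ᵐ[volume] u := by
  filter_upwards [(ae_restrict_iff' hΩ).1 h] with x hx
  by_cases hxΩ : x ∈ Ω
  · rw [zeroExt, Set.indicator_of_mem hxΩ, hx hxΩ]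
  · rw [zeroExt, Set.indicator_of_notMem hxΩ, hu x hxΩ]

theorem zeroExt_add (hΩ : MeasurableSet Ω) (f g : LTwo Ω) :
    zeroExt (f + g) =ᵐ[volume] zeroExt f + zeroExt g := by
  refine zeroExt_ae hΩ ?_ fun x hx => by simp [zeroExt, hx]
  filter_upwards [Lp.coeFn_add f g, ae_restrict_mem hΩ] with x hx hxΩ
  rw [hx]
  simp [zeroExt, hxΩ]

theorem zeroExt_smul (hΩ : MeasurableSet Ω) (c : ℝ) (f : LTwo Ω) :
    zeroExt (c • f) =ᵐ[volume] c • zeroExt f := by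
  refine zeroExt_ae hΩ ?_ fun x hx => by simp [zeroExt, hx]
  filter_upwards [Lp.coeFn_smul c f, ae_restrict_mem hΩ] with x hx hxΩ
  simp [hx, zeroExt, hxΩ]

theorem zeroExt_zero (hΩ : MeasurableSet Ω) : zeroExt (0 : LTwo Ω) =ᵐ[volume] 0 :=
  zeroExt_ae hΩ (Lp.coeFn_zero _ _ _) fun _ _ => rfl

theorem inner_eq_setIntegral (f g : LTwo Ω) : inner ℝ f g = ∫ x in Ω, f x * g x := by
  rw [L2.inner_def]
  refine integral_congr_ae (.of_forall fun x => ?_)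
  simp [mul_comm]

theorem inner_eq_integral_zeroExt (hΩ : MeasurableSet Ω) (f g : LTwo Ω) :
    inner ℝ f g = ∫ x, zeroExt f x * zeroExt g x := by
  rw [inner_eq_setIntegral, ← integral_indicator hΩ]
  refine integral_congr_ae (.of_forall fun x => ?_)
  by_cases hx : x ∈ Ω <;> simp [zeroExt, hx]

theorem integral_zeroExt_sq (hΩ : MeasurableSet Ω) (f : LTwo Ω) :
    ∫ x, zeroExt f x ^ 2 = ‖f‖ ^ 2 := by
  rw [← real_inner_self_eq_norm_sq, inner_eq_integral_zeroExt hΩ]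
  simp only [sq]

/-- The form domain as a subspace of `L²(Ω)`. -/
def formDomain (hΩ : MeasurableSet Ω) : Submodule ℝ (LTwo Ω) where
  carrier := {f | MemH Ω (zeroExt f)}
  zero_mem' := MemH.zero.congr (zeroExt_zero hΩ).symm (zeroExt_of_notMem _)
  add_mem' := fun {f g} hf hg =>
    (MemH.add hf hg).congr (zeroExt_add hΩ f g).symm (zeroExt_of_notMem _)
  smul_mem' := fun c f hf =>
    (MemH.const_smul hf c).congr (zeroExt_smul hΩ c f).symm (zeroExt_of_notMem _)

/-- The quadratic form of the logarithmic Laplacian as a bilinear map on its domain. -/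
def formMap (hN : 1 ≤ N) (hΩ : MeasurableSet Ω) (hbdd : Bornology.IsBounded Ω) :
    formDomain hΩ →ₗ[ℝ] formDomain hΩ →ₗ[ℝ] ℝ :=
  have hadd : ∀ f f' g : formDomain hΩ, logForm (zeroExt (f + f' : LTwo Ω)) (zeroExt (g : LTwo Ω)) =
      logForm (zeroExt f.1) (zeroExt g.1) + logForm (zeroExt f'.1) (zeroExt g.1) :=
    fun f f' g => (logForm_congr_left (zeroExt_add hΩ f.1 f'.1)).trans
      (logForm_add_left hN hΩ hbdd f.2 f'.2 g.2)
  have hsmul : ∀ (c : ℝ) (f g : formDomain hΩ),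
      logForm (zeroExt (c • f : LTwo Ω)) (zeroExt (g : LTwo Ω)) =
      c * logForm (zeroExt f.1) (zeroExt g.1) :=
    fun c f g => (logForm_congr_left (zeroExt_smul hΩ c f.1)).trans (logForm_smul_left c)
  LinearMap.mk₂ ℝ (fun f g => logForm (zeroExt f.1) (zeroExt g.1)) hadd hsmul
    (fun f g g' => by
      simp only [logForm_comm (u := zeroExt f.1)]
      exact hadd g g' f)
    (fun c f g => by
      simp only [logForm_comm (u := zeroExt f.1)]
      exact hsmul c g f)

theorem formMap_apply (hN : 1 ≤ N) (hΩ : MeasurableSet Ω) (hbdd : Bornology.IsBounded Ω)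
    (f g : formDomain hΩ) :
    formMap hN hΩ hbdd f g = logForm (zeroExt f.1) (zeroExt g.1) := rfl

/-- The lower-order part of the form as a bounded bilinear map on `L²(Ω)`. -/
def lowerMap (hN : 1 ≤ N) (hΩ : MeasurableSet Ω) (hbdd : Bornology.IsBounded Ω) :
    LTwo Ω →L[ℝ] LTwo Ω →L[ℝ] ℝ :=
  have hm := fun f : LTwo Ω => zeroExt_memLp hΩ f
  have hi := fun f : LTwo Ω => integrable_of_memLp hbdd (hm f) (zeroExt_of_notMem f)
  have hcongr : ∀ {u v w : EuclideanSpace ℝ (Fin N) → ℝ}, u =ᵐ[volume] v →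
      lowerForm u w = lowerForm v w := fun h => lowerForm_congr_left h
  have hadd : ∀ f f' g : LTwo Ω, lowerForm (zeroExt (f + f')) (zeroExt g) =
      lowerForm (zeroExt f) (zeroExt g) + lowerForm (zeroExt f') (zeroExt g) :=
    fun f f' g => (hcongr (zeroExt_add hΩ f f')).trans
      (lowerForm_add_left (hi f) (hi f') (hi g) (hm f) (hm f') (hm g))
  have hsmul : ∀ (c : ℝ) (f g : LTwo Ω), lowerForm (zeroExt (c • f)) (zeroExt g) =
      c * lowerForm (zeroExt f) (zeroExt g) :=
    fun c f g => (hcongr (zeroExt_smul hΩ c f)).trans (lowerForm_smul_left c)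
  LinearMap.mkContinuous₂ (LinearMap.mk₂ ℝ (fun f g => lowerForm (zeroExt f) (zeroExt g)) hadd hsmul
    (fun f g g' => by
      simp only [lowerForm_comm (u := zeroExt f)]
      exact hadd g g' f)
    (fun c f g => by
      simp only [lowerForm_comm (u := zeroExt f)]
      exact hsmul c g f)) (lowerConst N Ω) (fun f g => by
      have := abs_lowerForm_le hN hΩ hbdd (hm f) (zeroExt_of_notMem f) (hm g) (zeroExt_of_notMem g)
      rw [integral_zeroExt_sq hΩ, integral_zeroExt_sq hΩ, Real.sqrt_sq (norm_nonneg _),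
        Real.sqrt_sq (norm_nonneg _), ← mul_assoc] at this
      exact this)

theorem lowerMap_apply (hN : 1 ≤ N) (hΩ : MeasurableSet Ω) (hbdd : Bornology.IsBounded Ω)
    (f g : LTwo Ω) : lowerMap hN hΩ hbdd f g = lowerForm (zeroExt f) (zeroExt g) := rfl

theorem formMap_bddBelow (hN : 1 ≤ N) (hΩ : MeasurableSet Ω) (hbdd : Bornology.IsBounded Ω)
    (f : formDomain hΩ) : -lowerConst N Ω * ‖f‖ ^ 2 ≤ formMap hN hΩ hbdd f f := by
  have h1 := abs_lowerForm_self_le hN hΩ hbdd (zeroExt_memLp hΩ f.1) (zeroExt_of_notMem f.1)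
  have h2 := innerForm_self_nonneg (u := zeroExt f.1) hN
  rw [integral_zeroExt_sq hΩ] at h1
  rw [formMap_apply, logForm_eq, Submodule.coe_norm]
  linarith [(abs_le.1 h1).1]

end Ltwo

/-! ### Convolution with the truncated kernel and the lower trace bound -/

section Potential

variable {Ω : Set (EuclideanSpace ℝ (Fin N))} {δ : ℝ}

/-- The convolution of a function with the truncated kernel. -/
def annPot (δ : ℝ) (u : EuclideanSpace ℝ (Fin N) → ℝ) (x : EuclideanSpace ℝ (Fin N)) : ℝ :=
  ∫ y, u y * annKer N δ (x - y)

theorem memLp_annKer_sub (hN : 1 ≤ N) (h0 : 0 < δ) (x : EuclideanSpace ℝ (Fin N)) :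
    MemLp (fun y => annKer N δ (x - y)) 2 := by
  rw [memLp_two_iff_integrable_sq]
  · exact (integrable_annKer_sq hN h0).comp_sub_left x
  · exact ((measurable_annKer N δ).comp (measurable_const.sub measurable_id)).aestronglyMeasurable

/-- The kernel `y ↦ k(x - y)` as an element of `L²(Ω)`. -/
def annVec (Ω : Set (EuclideanSpace ℝ (Fin N))) (hN : 1 ≤ N) (h0 : 0 < δ)
    (x : EuclideanSpace ℝ (Fin N)) : LTwo Ω :=
  ((memLp_annKer_sub hN h0 x).restrict Ω).toLp _

theorem inner_annVec (hN : 1 ≤ N) (hΩ : MeasurableSet Ω) (h0 : 0 < δ)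
    (x : EuclideanSpace ℝ (Fin N)) (f : LTwo Ω) :
    inner ℝ f (annVec Ω hN h0 x) = annPot δ (zeroExt f) x := by
  rw [inner_eq_setIntegral, annPot]
  have h1 : ∀ y, zeroExt f y * annKer N δ (x - y) =
      Ω.indicator (fun y => f y * annKer N δ (x - y)) y := fun y => by
    by_cases hy : y ∈ Ω <;> simp [zeroExt, hy]
  simp only [h1]
  rw [integral_indicator hΩ]
  refine integral_congr_ae ?_
  filter_upwards [((memLp_annKer_sub hN h0 x).restrict Ω).coeFn_toLp] with y hy
  rw [annVec, hy]

theorem norm_annVec_sq_le (hN : 1 ≤ N) (h0 : 0 < δ) (x : EuclideanSpace ℝ (Fin N)) :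
    ‖annVec Ω hN h0 x‖ ^ 2 ≤ ∫ h, annKer N δ h ^ 2 := by
  rw [← real_inner_self_eq_norm_sq, inner_eq_setIntegral,
    ← integral_sub_left_eq_self (fun h => annKer N δ h ^ 2) volume x]
  refine le_trans (le_of_eq (integral_congr_ae ?_)) (setIntegral_le_integral (s := Ω)
    ((integrable_annKer_sq hN h0).comp_sub_left x) (.of_forall fun y => sq_nonneg _))
  filter_upwards [((memLp_annKer_sub hN h0 x).restrict Ω).coeFn_toLp] with y hy
  rw [annVec, hy, sq]

theorem aestronglyMeasurable_annPot (u : EuclideanSpace ℝ (Fin N) → ℝ)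
    (hu : AEStronglyMeasurable u) : AEStronglyMeasurable (annPot δ u) := by
  have : AEStronglyMeasurable (fun p : EuclideanSpace ℝ (Fin N) × EuclideanSpace ℝ (Fin N) =>
      u p.2 * annKer N δ (p.1 - p.2)) (volume.prod volume) :=
    hu.comp_snd.mul ((measurable_annKer N δ).comp
      (measurable_fst.sub measurable_snd)).aestronglyMeasurable
  exact this.integral_prod_right'

theorem abs_annPot_le (hN : 1 ≤ N) (hΩ : MeasurableSet Ω) (h0 : 0 < δ)
    (x : EuclideanSpace ℝ (Fin N)) (f : LTwo Ω) :
    |annPot δ (zeroExt f) x| ≤ ‖f‖ * √(∫ h, annKer N δ h ^ 2) := by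
  rw [← inner_annVec hN hΩ h0]
  refine (abs_real_inner_le_norm _ _).trans (mul_le_mul_of_nonneg_left ?_ (norm_nonneg _))
  exact Real.le_sqrt_of_sq_le (norm_annVec_sq_le hN h0 x)

theorem integrableOn_annPot_sq (hN : 1 ≤ N) (hΩ : MeasurableSet Ω) (hbdd : Bornology.IsBounded Ω)
    (h0 : 0 < δ) (f : LTwo Ω) : IntegrableOn (fun x => annPot δ (zeroExt f) x ^ 2) Ω := by
  refine Measure.integrableOn_of_bounded (M := (‖f‖ * √(∫ h, annKer N δ h ^ 2)) ^ 2)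
    hbdd.measure_lt_top.ne ?_ (.of_forall fun x => ?_)
  · exact (aestronglyMeasurable_annPot _ (zeroExt_memLp hΩ f).aestronglyMeasurable).pow 2
  · rw [norm_pow, Real.norm_eq_abs]
    exact pow_le_pow_left₀ (abs_nonneg _) (abs_annPot_le hN hΩ h0 x f) 2

/-- Coercivity up to a compact term. -/
theorem formMap_coercive (hN : 1 ≤ N) (hΩ : MeasurableSet Ω) (hbdd : Bornology.IsBounded Ω)
    (h0 : 0 < δ) (h1 : δ ≤ 1) (f : formDomain hΩ) :
    (2 * Real.log δ⁻¹ - (lowerConst N Ω + cConst N / 2)) * ‖f‖ ^ 2 ≤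
      formMap hN hΩ hbdd f f + cConst N / 2 * ∫ x in Ω, annPot δ (zeroExt f.1) x ^ 2 := by
  have hc := cConst_pos hN
  have hm := zeroExt_memLp hΩ f.1
  have hl := abs_lowerForm_self_le hN hΩ hbdd hm (zeroExt_of_notMem f.1)
  have hi := innerForm_self_ge hN h0 h1 f.2 hm
  have hp : ∫ p : EuclideanSpace ℝ (Fin N) × EuclideanSpace ℝ (Fin N),
      zeroExt f.1 p.1 * zeroExt f.1 p.2 * annKer N δ (p.1 - p.2) =
      ∫ x, zeroExt f.1 x * annPot δ (zeroExt f.1) x := by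
    have := integral_prod _ (integrable_mul_annKer hN h0 hm)
    rw [← Measure.volume_eq_prod] at this
    rw [this]
    simp only [annPot, mul_assoc, integral_const_mul]
  -- Young's inequality. The potential is needed only on Ω because the other factor vanishes
  -- elsewhere.
  have hle : ∫ x, zeroExt f.1 x * annPot δ (zeroExt f.1) x ≤
      1 / 2 * ((∫ x, zeroExt f.1 x ^ 2) + ∫ x in Ω, annPot δ (zeroExt f.1) x ^ 2) := by
    have hq := (integrable_indicator_iff hΩ).2 (integrableOn_annPot_sq hN hΩ hbdd h0 f.1)
    rw [← integral_indicator hΩ, ← integral_add hm.integrable_sq hq, ← integral_const_mul]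
    have hint : Integrable fun x => zeroExt f.1 x * annPot δ (zeroExt f.1) x := by
      have := (integrable_mul_annKer hN h0 hm).integral_prod_left
      simpa only [annPot, mul_assoc, integral_const_mul] using this
    refine integral_mono hint ((hm.integrable_sq.add hq).const_mul _) fun x => ?_
    by_cases hx : x ∈ Ω
    · simp only [Set.indicator_of_mem hx]
      nlinarith [sq_nonneg (zeroExt f.1 x - annPot δ (zeroExt f.1) x)]
    · simp [Set.indicator_of_notMem hx, zeroExt_of_notMem _ x hx]
  rw [integral_zeroExt_sq hΩ] at hl hi hle
  rw [hp] at hi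
  rw [formMap_apply, logForm_eq, Submodule.coe_norm]
  have := mul_le_mul_of_nonneg_left hle hc.le
  nlinarith [(abs_le.1 hl).1]

/-- The Berezin–Li–Yau type lower bound for traces. -/
theorem trace_ge (hN : 1 ≤ N) (hΩ : MeasurableSet Ω) (hbdd : Bornology.IsBounded Ω) :
    ∃ C, ∀ (k : ℕ), 1 ≤ k → ∀ φ : Fin k → formDomain hΩ, Orthonormal ℝ φ →
      k * (2 / N * Real.log k - C) ≤ ∑ i, formMap hN hΩ hbdd (φ i) (φ i) := by
  have hc := cConst_pos hN
  refine ⟨lowerConst N Ω + cConst N / 2 + cConst N / 2 * (volume.real Ω * ballVol N),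
    fun k hk φ hφ => ?_⟩
  have hk0 : (0 : ℝ) < k := by exact_mod_cast hk
  have hN0 : (N : ℝ) ≠ 0 := by exact_mod_cast (Nat.one_le_iff_ne_zero.1 hN)
  -- The choice with δ^(-N) = k: the Bessel error becomes O(k), while 2 ln(1/δ) = (2/N) ln k.
  set δ : ℝ := (k : ℝ) ^ (-(1 / N : ℝ))
  have h0 : 0 < δ := Real.rpow_pos_of_pos hk0 _
  have h1 : δ ≤ 1 := Real.rpow_le_one_of_one_le_of_nonpos (by exact_mod_cast hk)
    (neg_nonpos.2 (by positivity))
  have hlog : 2 * Real.log δ⁻¹ = 2 / N * Real.log k := by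
    rw [Real.log_inv, Real.log_rpow hk0]; ring
  have hpow : (δ ^ N)⁻¹ = k := by
    rw [← Real.rpow_natCast, ← Real.rpow_mul hk0.le, neg_mul, one_div_mul_cancel hN0,
      Real.rpow_neg_one, inv_inv]
  have hsum := Finset.sum_le_sum fun i (_ : i ∈ Finset.univ) =>
    formMap_coercive hN hΩ hbdd h0 h1 (φ i)
  rw [hlog] at hsum
  simp only [hφ.1, one_pow, mul_one, Finset.sum_const, Finset.card_univ, Fintype.card_fin,
    nsmul_eq_mul, Finset.sum_add_distrib, ← Finset.mul_sum] at hsum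
  have hφ' : Orthonormal ℝ fun i => (φ i : LTwo Ω) :=
    hφ.comp_linearIsometry (formDomain hΩ).subtypeₗᵢ
  have hB : ∑ i, ∫ x in Ω, annPot δ (zeroExt (φ i).1) x ^ 2 ≤
      volume.real Ω * (ballVol N * k) := by
    rw [← integral_finsetSum _ fun i _ => integrableOn_annPot_sq hN hΩ hbdd h0 (φ i).1]
    have hfin : IsFiniteMeasure (volume.restrict Ω) := ⟨by
      rw [Measure.restrict_apply_univ]; exact hbdd.measure_lt_top⟩
    refine (integral_mono (g := fun _ => ballVol N * k) (integrable_finsetSum _ fun i _ =>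
      integrableOn_annPot_sq hN hΩ hbdd h0 (φ i).1) (integrable_const _) fun x => ?_).trans_eq ?_
    -- For fixed x the potentials of the φ i are Fourier coefficients of the single vector k_δ(x -
    -- ·), so Bessel gives a bound independent of k before δ is inserted.
    · have hb := hφ'.sum_inner_products_le (x := annVec Ω hN h0 x) (s := Finset.univ)
      simp only [inner_annVec hN hΩ h0, Real.norm_eq_abs, sq_abs] at hb
      refine (hb.trans (norm_annVec_sq_le hN h0 x)).trans ?_
      rw [← hpow]
      exact integral_annKer_sq_le hN h0 h1
    · simp
  have := mul_le_mul_of_nonneg_left hB (half_pos hc).le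
  nlinarith

end Potential

/-- Bounded sequences in a separable Hilbert space have weakly convergent subsequences. -/
theorem exists_weakly_tendsto_subseq {H : Type*} [NormedAddCommGroup H] [InnerProductSpace ℝ H]
    [CompleteSpace H] [TopologicalSpace.SeparableSpace H] {u : ℕ → H} {r : ℝ}
    (hu : ∀ n, ‖u n‖ ≤ r) :
    ∃ φ : ℕ → ℕ, StrictMono φ ∧
      ∀ g, ∃ l, Tendsto (fun n => (inner ℝ (u (φ n)) g : ℝ)) atTop (𝓝 l) := by
  obtain ⟨a, -, φ, hφ, h⟩ := WeakDual.isSeqCompact_closedBall ℝ H 0 r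
    (x := fun n => WeakDual.toStrongDual.symm (InnerProductSpace.toDual ℝ H (u n))) fun n => by
      rw [Set.mem_preimage, LinearEquiv.apply_symm_apply, mem_closedBall_zero_iff,
        LinearIsometryEquiv.norm_map]
      exact hu n
  exact ⟨φ, hφ, fun g => ⟨a g, ((WeakDual.eval_continuous g).tendsto a).comp h⟩⟩

/-! ### Compactness and lower semicontinuity of the form -/

section Compactness

variable {Ω : Set (EuclideanSpace ℝ (Fin N))} {δ : ℝ}

/-- Each value of the potential is an inner product with a fixed vector, so weak convergence gives
pointwise convergence of differences to 0. The uniform bound on a set of finite measure permits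
dominated convergence. -/
theorem tendsto_integral_annPot_sub_sq (hN : 1 ≤ N) (hΩ : MeasurableSet Ω)
    (hbdd : Bornology.IsBounded Ω) (h0 : 0 < δ) {u : ℕ → LTwo Ω} {r : ℝ} (hu : ∀ n, ‖u n‖ ≤ r)
    (hw : ∀ g, ∃ l, Tendsto (fun n => (inner ℝ (u n) g : ℝ)) atTop (𝓝 l)) :
    Tendsto (fun p : ℕ × ℕ => ∫ x in Ω, annPot δ (zeroExt (u p.1 - u p.2)) x ^ 2)
      (atTop ×ˢ atTop) (𝓝 0) := by
  have hfin : IsFiniteMeasure (volume.restrict Ω) := ⟨by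
    rw [Measure.restrict_apply_univ]; exact hbdd.measure_lt_top⟩
  have := tendsto_integral_filter_of_dominated_convergence (μ := volume.restrict Ω)
    (l := (atTop ×ˢ atTop : Filter (ℕ × ℕ)))
    (F := fun p x => annPot δ (zeroExt (u p.1 - u p.2)) x ^ 2) (f := fun _ => 0)
    (fun _ => ((r + r) * √(∫ h, annKer N δ h ^ 2)) ^ 2) ?_ ?_ (integrable_const _) ?_
  · simpa using this
  · exact .of_forall fun p => (integrableOn_annPot_sq hN hΩ hbdd h0 _).aestronglyMeasurable
  · refine .of_forall fun p => .of_forall fun x => ?_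
    rw [norm_pow, Real.norm_eq_abs]
    refine pow_le_pow_left₀ (abs_nonneg _) ((abs_annPot_le hN hΩ h0 x _).trans ?_) 2
    exact mul_le_mul_of_nonneg_right ((norm_sub_le _ _).trans (add_le_add (hu _) (hu _)))
      (Real.sqrt_nonneg _)
  · refine .of_forall fun x => ?_
    obtain ⟨l, hl⟩ := hw (annVec Ω hN h0 x)
    have h1 : Tendsto (fun p : ℕ × ℕ => (inner ℝ (u p.1) (annVec Ω hN h0 x) -
        inner ℝ (u p.2) (annVec Ω hN h0 x) : ℝ) ^ 2) (atTop ×ˢ atTop) (𝓝 ((l - l) ^ 2)) :=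
      ((hl.comp tendsto_fst).sub (hl.comp tendsto_snd)).pow 2
    simp only [← inner_sub_left, sub_self, zero_pow two_ne_zero] at h1
    simpa only [inner_annVec hN hΩ h0] using h1

/-- The parallelogram identity, with the form at f + g bounded from below. -/
theorem formMap_sub_le (hN : 1 ≤ N) (hΩ : MeasurableSet Ω) (hbdd : Bornology.IsBounded Ω)
    (f g : formDomain hΩ) :
    formMap hN hΩ hbdd (f - g) (f - g) ≤ 2 * formMap hN hΩ hbdd f f +
      2 * formMap hN hΩ hbdd g g + lowerConst N Ω * ‖f + g‖ ^ 2 := by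
  have h := formMap_bddBelow hN hΩ hbdd (f + g)
  simp only [map_add, map_sub, LinearMap.add_apply, LinearMap.sub_apply] at h ⊢
  linarith

theorem lowerConst_nonneg (hN : 1 ≤ N) : 0 ≤ lowerConst N Ω :=
  add_nonneg (mul_nonneg (cConst_pos hN).le measureReal_nonneg) (abs_nonneg _)

/-- Weakly convergent sequences with bounded form are norm convergent. -/
theorem cauchySeq_of_weakly_tendsto (hN : 1 ≤ N) (hΩ : MeasurableSet Ω)
    (hbdd : Bornology.IsBounded Ω) {u : ℕ → formDomain hΩ} {M : ℝ} (hu : ∀ n, ‖u n‖ ≤ 1)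
    (hM : ∀ n, formMap hN hΩ hbdd (u n) (u n) ≤ M)
    (hw : ∀ g, ∃ l, Tendsto (fun n => (inner ℝ (u n : LTwo Ω) g : ℝ)) atTop (𝓝 l)) :
    CauchySeq u := by
  have hc := cConst_pos hN
  have hl := lowerConst_nonneg (Ω := Ω) hN
  rw [Metric.cauchySeq_iff]
  intro ε hε
  -- Here t = ln(1/δ). The form at u m - u n is at most 4M + 4 `lowerConst`, and the extra 1 absorbs
  -- the compact term for large m, n; coercivity with so large a t forces ‖u m - u n‖ < ε.
  obtain ⟨t, ht0, ht⟩ : ∃ t : ℝ, 0 ≤ t ∧ 4 * M + 4 * lowerConst N Ω + 1 <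
      (2 * t - (lowerConst N Ω + cConst N / 2)) * ε ^ 2 ∧
      0 < 2 * t - (lowerConst N Ω + cConst N / 2) := by
    refine ⟨max ((|4 * M + 4 * lowerConst N Ω + 1| / ε ^ 2 + 1 + (lowerConst N Ω + cConst N / 2)) / 2)
      0, le_max_right _ _, ?_, ?_⟩
    · have h1 := le_max_left
        ((|4 * M + 4 * lowerConst N Ω + 1| / ε ^ 2 + 1 + (lowerConst N Ω + cConst N / 2)) / 2) 0
      have h2 : |4 * M + 4 * lowerConst N Ω + 1| / ε ^ 2 < 2 * max
        ((|4 * M + 4 * lowerConst N Ω + 1| / ε ^ 2 + 1 + (lowerConst N Ω + cConst N / 2)) / 2) 0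
          - (lowerConst N Ω + cConst N / 2) := by linarith
      rw [div_lt_iff₀ (by positivity)] at h2
      exact (le_abs_self _).trans_lt h2
    · have h1 := le_max_left
        ((|4 * M + 4 * lowerConst N Ω + 1| / ε ^ 2 + 1 + (lowerConst N Ω + cConst N / 2)) / 2) 0
      have : 0 ≤ |4 * M + 4 * lowerConst N Ω + 1| / ε ^ 2 := by positivity
      linarith
  have hlog : Real.log (Real.exp (-t))⁻¹ = t := by rw [← Real.exp_neg, neg_neg, Real.log_exp]
  have hlim := tendsto_integral_annPot_sub_sq hN hΩ hbdd (Real.exp_pos (-t))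
    (u := fun n => (u n : LTwo Ω)) (r := 1) hu hw
  have hev : ∀ᶠ p : ℕ × ℕ in atTop ×ˢ atTop, cConst N / 2 *
      ∫ x in Ω, annPot (Real.exp (-t)) (zeroExt ((u p.1 : LTwo Ω) - (u p.2 : LTwo Ω))) x ^ 2 < 1 := by
    have := hlim.const_mul (cConst N / 2)
    rw [mul_zero] at this
    exact this.eventually_lt_const one_pos
  rw [prod_atTop_atTop_eq] at hev
  obtain ⟨⟨a, b⟩, hab⟩ := eventually_atTop.1 hev
  refine ⟨max a b, fun m hm n hn => ?_⟩
  have h1 := hab (m, n) ⟨(le_max_left _ _).trans hm, (le_max_right _ _).trans hn⟩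
  have h2 := formMap_coercive hN hΩ hbdd (Real.exp_pos (-t))
    (Real.exp_le_one_iff.2 (neg_nonpos.2 ht0)) (u m - u n)
  rw [hlog] at h2
  have h3 := formMap_sub_le hN hΩ hbdd (u m) (u n)
  have h4 : ‖u m + u n‖ ^ 2 ≤ 4 := by
    have h := (norm_add_le (u m) (u n)).trans (add_le_add (hu m) (hu n))
    nlinarith [norm_nonneg (u m + u n)]
  have h5 := mul_le_mul_of_nonneg_left h4 hl
  rw [dist_eq_norm]
  refine lt_of_pow_lt_pow_left₀ 2 hε.le (lt_of_mul_lt_mul_left (a := 2 * t -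
    (lowerConst N Ω + cConst N / 2)) ?_ ht.2.le)
  have h6 : ((u m - u n : formDomain hΩ) : LTwo Ω) = (u m : LTwo Ω) - u n := rfl
  rw [h6] at h2
  linarith [hM m, hM n, ht.1]

theorem innerForm_self_eq (u : EuclideanSpace ℝ (Fin N) → ℝ) :
    innerForm u u = cConst N / 2 *
      ∫ p in nearSet N, (u p.1 - u p.2) ^ 2 / ‖p.1 - p.2‖ ^ N := by
  simp only [innerForm, sq]

/-- The form is lower semicontinuous with respect to convergence in `L²(Ω)`. -/
theorem mem_formDomain_of_tendsto (hN : 1 ≤ N) (hΩ : MeasurableSet Ω)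
    (hbdd : Bornology.IsBounded Ω) {u : ℕ → formDomain hΩ} {f : LTwo Ω} {t : ℕ → ℝ} {c : ℝ}
    (hf : Tendsto (fun n => (u n : LTwo Ω)) atTop (𝓝 f))
    (ht : ∀ n, formMap hN hΩ hbdd (u n) (u n) ≤ t n) (htc : Tendsto t atTop (𝓝 c)) :
    ∃ hmem : f ∈ formDomain hΩ, formMap hN hΩ hbdd ⟨f, hmem⟩ ⟨f, hmem⟩ ≤ c := by
  have hc := cConst_pos hN
  -- Fatou's lemma along an a.e. convergent subsequence handles the near part; the lower-order part
  -- is continuous on L²(Ω) and converges. Finiteness of the Fatou bound is also what puts f in the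
  -- form domain.
  obtain ⟨ns, hns, hae⟩ := (tendstoInMeasure_of_tendsto_Lp hf).exists_seq_tendsto_ae
  have hae' : ∀ᵐ x, Tendsto (fun i => zeroExt (u (ns i)).1 x) atTop (𝓝 (zeroExt f x)) := by
    filter_upwards [(ae_restrict_iff' hΩ).1 hae] with x hx
    by_cases hxΩ : x ∈ Ω
    · simpa [zeroExt, hxΩ] using hx hxΩ
    · simp [zeroExt, hxΩ]
  set q : (EuclideanSpace ℝ (Fin N) → ℝ) →
      EuclideanSpace ℝ (Fin N) × EuclideanSpace ℝ (Fin N) → ℝ :=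
    fun v p => (v p.1 - v p.2) ^ 2 / ‖p.1 - p.2‖ ^ N
  have hq0 : ∀ v p, 0 ≤ q v p := fun v p => by positivity
  have hqm : ∀ g : LTwo Ω, AEMeasurable (q (zeroExt g)) := fun g =>
    ((aemeasurable_sub_comp (zeroExt_memLp hΩ g).aestronglyMeasurable.aemeasurable).pow_const 2).div
      measurable_norm_sub_pow.aemeasurable
  have hlow : Tendsto (fun i => lowerMap hN hΩ hbdd (u (ns i)) (u (ns i))) atTop
      (𝓝 (lowerMap hN hΩ hbdd f f)) := by
    have hcont : Continuous fun g : LTwo Ω => lowerMap hN hΩ hbdd g g :=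
      (lowerMap hN hΩ hbdd).continuous₂.comp (continuous_id.prodMk continuous_id)
    exact (hcont.tendsto f).comp (hf.comp hns.tendsto_atTop)
  set s : ℝ := (cConst N / 2)⁻¹ * (c - lowerMap hN hΩ hbdd f f)
  have hs : Tendsto (fun i => ENNReal.ofReal ((cConst N / 2)⁻¹ *
      (t (ns i) - lowerMap hN hΩ hbdd (u (ns i)) (u (ns i))))) atTop (𝓝 (ENNReal.ofReal s)) :=
    ENNReal.tendsto_ofReal (((htc.comp hns.tendsto_atTop).sub hlow).const_mul _)
  have hle : ∀ i, ∫⁻ p in nearSet N, ENNReal.ofReal (q (zeroExt (u (ns i)).1) p) ≤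
      ENNReal.ofReal ((cConst N / 2)⁻¹ *
      (t (ns i) - lowerMap hN hΩ hbdd (u (ns i)) (u (ns i)))) := fun i => by
    rw [← ofReal_integral_eq_lintegral_ofReal (u (ns i)).2.integrableOn (.of_forall (hq0 _))]
    refine ENNReal.ofReal_le_ofReal ?_
    have h1 := ht (ns i)
    rw [formMap_apply, logForm_eq, innerForm_self_eq] at h1
    rw [← div_eq_inv_mul, le_div_iff₀ (by positivity), lowerMap_apply, mul_comm]
    linarith
  have hfatou : ∫⁻ p in nearSet N, ENNReal.ofReal (q (zeroExt f) p) ≤ ENNReal.ofReal s := by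
    calc ∫⁻ p in nearSet N, ENNReal.ofReal (q (zeroExt f) p)
        = ∫⁻ p in nearSet N, liminf (fun i => ENNReal.ofReal (q (zeroExt (u (ns i)).1) p)) atTop := by
          refine lintegral_congr_ae (ae_restrict_of_ae ?_)
          filter_upwards [Measure.quasiMeasurePreserving_fst.ae hae',
            Measure.quasiMeasurePreserving_snd.ae hae'] with p h1 h2
          exact (ENNReal.tendsto_ofReal (((h1.sub h2).pow 2).div_const _)).liminf_eq.symm
      _ ≤ liminf (fun i => ∫⁻ p in nearSet N, ENNReal.ofReal (q (zeroExt (u (ns i)).1) p)) atTop :=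
          lintegral_liminf_le' fun i => (hqm _).ennreal_ofReal.restrict
      _ ≤ liminf (fun i => ENNReal.ofReal ((cConst N / 2)⁻¹ *
            (t (ns i) - lowerMap hN hΩ hbdd (u (ns i)) (u (ns i))))) atTop :=
          liminf_le_liminf (.of_forall hle)
      _ = ENNReal.ofReal s := hs.liminf_eq
  have hint : IntegrableOn (q (zeroExt f)) (nearSet N) :=
    (lintegral_ofReal_ne_top_iff_integrable (hqm f).aestronglyMeasurable.restrict
      (.of_forall (hq0 _))).1 (hfatou.trans_lt ENNReal.ofReal_lt_top).ne
  have hs0 : 0 ≤ s := by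
    refine ge_of_tendsto (((htc.comp hns.tendsto_atTop).sub hlow).const_mul (cConst N / 2)⁻¹)
      (.of_forall fun i => mul_nonneg (by positivity) ?_)
    have h1 := ht (ns i)
    rw [formMap_apply, logForm_eq] at h1
    have h2 := innerForm_self_nonneg (u := zeroExt (u (ns i)).1) hN
    rw [lowerMap_apply, Function.comp_apply]
    linarith
  refine ⟨⟨(zeroExt_memLp hΩ f).aestronglyMeasurable.aemeasurable, zeroExt_of_notMem f, hint⟩, ?_⟩
  rw [← ofReal_integral_eq_lintegral_ofReal hint (.of_forall (hq0 _)),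
    ENNReal.ofReal_le_ofReal_iff hs0] at hfatou
  rw [formMap_apply, logForm_eq, innerForm_self_eq]
  have h3 := mul_le_mul_of_nonneg_left hfatou (half_pos hc).le
  rw [mul_inv_cancel_left₀ (half_pos hc).ne', lowerMap_apply] at h3
  linarith

theorem formCompact_formMap (hN : 1 ≤ N) (hΩ : MeasurableSet Ω) (hbdd : Bornology.IsBounded Ω) :
    FormCompact (formMap hN hΩ hbdd) := by
  intro u t c hu ht htc
  have : Fact ((2 : ENNReal) ≠ ⊤) := ⟨ENNReal.ofNat_ne_top⟩
  obtain ⟨φ, hφ, hw⟩ := exists_weakly_tendsto_subseq (H := LTwo Ω) (u := fun n => (u n : LTwo Ω))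
    (r := 1) hu
  obtain ⟨M, hM⟩ := htc.bddAbove_range
  have hcau := cauchySeq_of_weakly_tendsto hN hΩ hbdd (u := u ∘ φ) (M := M) (fun n => hu _)
    (fun n => (ht _).trans (hM ⟨_, rfl⟩)) hw
  have hcau' : CauchySeq fun n => (u (φ n) : LTwo Ω) := hcau.map uniformContinuous_subtype_val
  obtain ⟨f, hf⟩ := cauchySeq_tendsto_of_complete hcau'
  obtain ⟨hmem, hle⟩ := mem_formDomain_of_tendsto hN hΩ hbdd (u := u ∘ φ) hf (fun n => ht _)
    (htc.comp hφ.tendsto_atTop)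
  exact ⟨⟨f, hmem⟩, φ, hφ, tendsto_subtype_rng.2 hf, hle⟩

end Compactness

/-! ### Energy of Lipschitz functions -/

section Lipschitz

variable {Ω S : Set (EuclideanSpace ℝ (Fin N))} {u : EuclideanSpace ℝ (Fin N) → ℝ} {η K : ℝ}

/-- The kernel `|h|^(2-N)` truncated to `|h| ≤ η`. -/
def ballKer (N : ℕ) (η : ℝ) (h : EuclideanSpace ℝ (Fin N)) : ℝ :=
  (Set.Iic η).indicator (fun r => r ^ 2 * (r ^ N)⁻¹) ‖h‖

theorem ballKer_nonneg (h : EuclideanSpace ℝ (Fin N)) : 0 ≤ ballKer N η h :=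
  Set.indicator_apply_nonneg fun _ => by positivity

theorem ballKer_neg (h : EuclideanSpace ℝ (Fin N)) : ballKer N η (-h) = ballKer N η h := by
  simp [ballKer]

theorem ballKer_radial (hN : 1 ≤ N) (η : ℝ) (y : ℝ) (hy : 0 < y) :
    y ^ (N - 1) * (Set.Iic η).indicator (fun r => r ^ 2 * (r ^ N)⁻¹) y =
      (Set.Iic η).indicator (fun r => r) y := by
  unfold Set.indicator
  split_ifs
  · rw [mul_left_comm, pow_pred_mul_inv hN hy, sq, mul_assoc, mul_inv_cancel₀ hy.ne', mul_one]
  · simp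

theorem integrable_ballKer (hN : 1 ≤ N) (η : ℝ) : Integrable (ballKer N η) := by
  refine (integrable_radial hN (ballKer_radial hN η)).2 ?_
  rw [IntegrableOn, integrable_indicator_iff measurableSet_Iic, IntegrableOn,
    Measure.restrict_restrict measurableSet_Iic, Set.Iic_inter_Ioi]
  exact (continuous_id.integrableOn_Icc (a := 0) (b := η)).mono_set Set.Ioc_subset_Icc_self

theorem integral_ballKer (hN : 1 ≤ N) (h0 : 0 ≤ η) : cConst N * ∫ h, ballKer N η h = η ^ 2 := by
  have := integral_radial hN (ballKer_radial hN η)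
  unfold ballKer
  rw [this, setIntegral_indicator measurableSet_Iic, Set.Ioi_inter_Iic,
    ← intervalIntegral.integral_of_le h0, integral_id, ← mul_assoc, cConst_mul_sphere hN]
  ring

theorem sq_sub_le_of_lipschitz (hS : ∀ x, x ∉ S → u x = 0)
    (hK : ∀ x y, |u x - u y| ≤ K * ‖x - y‖)
    (p : EuclideanSpace ℝ (Fin N) × EuclideanSpace ℝ (Fin N)) :
    (u p.1 - u p.2) ^ 2 ≤
      (S.indicator (fun _ => K ^ 2) p.1 + S.indicator (fun _ => K ^ 2) p.2) * ‖p.1 - p.2‖ ^ 2 := by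
  have h1 : (u p.1 - u p.2) ^ 2 ≤ K ^ 2 * ‖p.1 - p.2‖ ^ 2 := by
    rw [← sq_abs, ← mul_pow]
    exact pow_le_pow_left₀ (abs_nonneg _) (hK _ _) 2
  have h2 : 0 ≤ K ^ 2 * ‖p.1 - p.2‖ ^ 2 := by positivity
  by_cases hx : p.1 ∈ S <;> by_cases hy : p.2 ∈ S
  · simp only [Set.indicator_of_mem hx, Set.indicator_of_mem hy]; linarith
  · simpa [hx, hy] using h1
  · simpa [hx, hy] using h1
  · simp [hx, hy, hS]

theorem integrable_indicator_sq (hSm : MeasurableSet S) (hSf : volume S ≠ ⊤) :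
    Integrable (S.indicator fun _ => K ^ 2) :=
  (integrable_indicator_iff hSm).2 (integrableOn_const hSf)

theorem memH_of_lipschitz (hN : 1 ≤ N) (hSm : MeasurableSet S) (hSf : volume S ≠ ⊤) (hSΩ : S ⊆ Ω)
    (hu : AEMeasurable u) (hS : ∀ x, x ∉ S → u x = 0) (hK : ∀ x y, |u x - u y| ≤ K * ‖x - y‖) :
    MemH Ω u where
  aemeasurable := hu
  eq_zero := fun x hx => hS x fun h => hx (hSΩ h)
  integrableOn := by
    have hi := integrable_indicator_sq (K := K) hSm hSf
    have hk := integrable_ballKer hN 1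
    refine Integrable.mono' ((integrable_conv_fst hi hk fun x => ballKer_neg x).add
      (integrable_conv_snd hi hk)).integrableOn ?_ ?_
    · exact (((aemeasurable_sub_comp hu).pow_const 2).div
        measurable_norm_sub_pow.aemeasurable).aestronglyMeasurable.restrict
    · refine (ae_restrict_iff' measurableSet_nearSet).2 (.of_forall fun p hp => ?_)
      rw [Real.norm_eq_abs, abs_of_nonneg (by positivity), Pi.add_apply, ← add_mul, ballKer,
        Set.indicator_of_mem (show ‖p.1 - p.2‖ ∈ Set.Iic 1 from hp), ← mul_assoc, div_eq_mul_inv]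
      exact mul_le_mul_of_nonneg_right (sq_sub_le_of_lipschitz hS hK p) (by positivity)

/-- Below distance η the Lipschitz bound applies; above it, nonnegativity gives (u x - u y)² ≤ u(x)²
+ u(y)². For functions of varying sign a factor 2 would appear here and spoil the leading constant.
-/
theorem innerForm_le_of_lipschitz (hN : 1 ≤ N) (h0 : 0 < η) (h1 : η ≤ 1) (hSm : MeasurableSet S)
    (hSf : volume S ≠ ⊤) (hu2 : MemLp u 2) (hu0 : ∀ x, 0 ≤ u x)
    (hS : ∀ x, x ∉ S → u x = 0) (hK : ∀ x y, |u x - u y| ≤ K * ‖x - y‖) :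
    innerForm u u ≤ 2 * Real.log η⁻¹ * (∫ x, u x ^ 2) + K ^ 2 * volume.real S * η ^ 2 := by
  have hc := cConst_pos hN
  have hi := integrable_indicator_sq (K := K) hSm hSf
  have hk := integrable_ballKer hN η
  have ha := integrable_annKer hN h0
  have i1 := integrable_conv_fst hi hk fun x => ballKer_neg x
  have i2 := integrable_conv_snd hi hk
  have i3 := integrable_conv_fst hu2.integrable_sq ha fun x => annKer_neg x
  have i4 := integrable_conv_snd hu2.integrable_sq ha
  have hle : ∫ p in nearSet N, (u p.1 - u p.2) ^ 2 / ‖p.1 - p.2‖ ^ N ≤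
      2 * ((K ^ 2 * volume.real S) * ∫ h, ballKer N η h) +
      2 * ((∫ x, u x ^ 2) * ∫ h, annKer N η h) := by
    have e1 := integral_conv_fst hi hk fun x => ballKer_neg x
    have e2 := integral_conv_snd hi hk
    have e3 := integral_conv_fst hu2.integrable_sq ha fun x => annKer_neg x
    have e4 := integral_conv_snd hu2.integrable_sq ha
    rw [integral_indicator_const _ hSm, smul_eq_mul, mul_comm (volume.real S)] at e1 e2
    rw [← integral_indicator measurableSet_nearSet]
    refine (integral_mono_of_nonneg (.of_forall fun p => Set.indicator_apply_nonneg fun _ => ?_)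
      ((i1.add i2).add (i3.add i4)) (.of_forall fun p => ?_)).trans_eq ?_
    · positivity
    · simp only [Pi.add_apply, ← add_mul]
      have hb : 0 ≤ (S.indicator (fun _ => K ^ 2) p.1 + S.indicator (fun _ => K ^ 2) p.2) *
          ballKer N η (p.1 - p.2) :=
        mul_nonneg (add_nonneg (Set.indicator_apply_nonneg fun _ => sq_nonneg _)
          (Set.indicator_apply_nonneg fun _ => sq_nonneg _)) (ballKer_nonneg _)
      have ha' : 0 ≤ (u p.1 ^ 2 + u p.2 ^ 2) * annKer N η (p.1 - p.2) :=
        mul_nonneg (by positivity) (annKer_nonneg _)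
      by_cases hp : p ∈ nearSet N
      · rw [Set.indicator_of_mem hp]
        rcases le_or_gt ‖p.1 - p.2‖ η with hη | hη
        · refine le_trans ?_ (le_add_of_nonneg_right ha')
          rw [ballKer, Set.indicator_of_mem (show ‖p.1 - p.2‖ ∈ Set.Iic η from hη), ← mul_assoc,
            div_eq_mul_inv]
          exact mul_le_mul_of_nonneg_right (sq_sub_le_of_lipschitz hS hK p) (by positivity)
        · refine le_trans ?_ (le_add_of_nonneg_left hb)
          rw [annKer, Set.indicator_of_mem (show ‖p.1 - p.2‖ ∈ Set.Icc η 1 from ⟨hη.le, hp⟩),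
            div_eq_mul_inv]
          refine mul_le_mul_of_nonneg_right ?_ (by positivity)
          nlinarith [mul_nonneg (hu0 p.1) (hu0 p.2)]
      · rw [Set.indicator_of_notMem hp]
        exact add_nonneg hb ha'
    · refine (integral_add (i1.add i2) (i3.add i4)).trans ?_
      rw [integral_add' i1 i2, integral_add' i3 i4, e1, e2, e3, e4]
      ring
  have h3 := mul_le_mul_of_nonneg_left hle (half_pos hc).le
  rw [innerForm_self_eq]
  refine h3.trans_eq ?_
  rw [← integral_annKer hN h0 h1, ← integral_ballKer hN h0.le]
  ring

end Lipschitz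

/-! ### Tent functions -/

section Tent

variable {Ω : Set (EuclideanSpace ℝ (Fin N))} {η : ℝ} {a : EuclideanSpace ℝ (Fin N)}

/-- The tent function of radius `η` centred at `a`. -/
def tent (a : EuclideanSpace ℝ (Fin N)) (η : ℝ) (x : EuclideanSpace ℝ (Fin N)) : ℝ :=
  max 0 (η - ‖x - a‖)

theorem tent_nonneg (x : EuclideanSpace ℝ (Fin N)) : 0 ≤ tent a η x := le_max_left _ _

theorem tent_eq_zero (x : EuclideanSpace ℝ (Fin N)) (hx : x ∉ Metric.ball a η) :
    tent a η x = 0 := by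
  rw [mem_ball_iff_norm, not_lt] at hx
  exact max_eq_left (by linarith)

theorem continuous_tent : Continuous (tent a η) := by unfold tent; fun_prop

theorem tent_lipschitz (x y : EuclideanSpace ℝ (Fin N)) :
    |tent a η x - tent a η y| ≤ 1 * ‖x - y‖ := by
  rw [one_mul]
  refine (abs_max_sub_max_le_max _ _ _ _).trans ?_
  rw [sub_self, abs_zero, sub_sub_sub_cancel_left]
  refine max_le (norm_nonneg _) ((abs_norm_sub_norm_le _ _).trans_eq ?_)
  rw [sub_sub_sub_cancel_right, norm_sub_rev]

theorem volume_real_ball (h0 : 0 < η) :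
    volume.real (Metric.ball a η) = η ^ N * ballVol N := by
  rw [measureReal_def, Measure.addHaar_ball_of_pos _ _ h0, ENNReal.toReal_mul,
    ENNReal.toReal_ofReal (by positivity), finrank_euclideanSpace_fin]
  rfl

theorem tent_memH (hN : 1 ≤ N) (hball : Metric.ball a η ⊆ Ω) : MemH Ω (tent a η) :=
  memH_of_lipschitz hN measurableSet_ball measure_ball_lt_top.ne hball
    continuous_tent.measurable.aemeasurable tent_eq_zero tent_lipschitz

/-- The tent is at least η/2 on the ball of half the radius. Hence the short-range energy, of order
η^(N+2), is at most a constant multiple of the squared norm, uniformly in η. -/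
theorem integral_tent_sq_ge (h0 : 0 < η) (h2 : MemLp (tent a η) 2) :
    ballVol N * η ^ (N + 2) ≤ 2 ^ (N + 2) * ∫ x, tent a η x ^ 2 := by
  have h1 : ∫ x in Metric.ball a (η / 2), (η / 2) ^ 2 ≤ ∫ x, tent a η x ^ 2 := by
    refine (setIntegral_mono_on (integrableOn_const measure_ball_lt_top.ne)
      h2.integrable_sq.integrableOn measurableSet_ball fun x hx => ?_).trans
      (setIntegral_le_integral h2.integrable_sq (.of_forall fun x => sq_nonneg _))
    refine pow_le_pow_left₀ (by positivity) (le_max_of_le_right ?_) 2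
    rw [mem_ball_iff_norm] at hx
    linarith
  rw [setIntegral_const, volume_real_ball (by positivity), smul_eq_mul] at h1
  refine le_trans (le_of_eq ?_) (mul_le_mul_of_nonneg_left h1 (by positivity))
  rw [mul_right_comm, ← pow_add, div_pow, mul_comm (ballVol N)]
  field_simp

theorem tent_logForm_le (hN : 1 ≤ N) (hΩ : MeasurableSet Ω) (hbdd : Bornology.IsBounded Ω)
    (h0 : 0 < η) (h1 : η ≤ 1) (hball : Metric.ball a η ⊆ Ω) :
    logForm (tent a η) (tent a η) ≤
      (2 * Real.log η⁻¹ + (2 ^ (N + 2) + lowerConst N Ω)) * ∫ x, tent a η x ^ 2 := by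
  have hH := tent_memH hN hball
  have h2 := hH.memLp hN hΩ hbdd
  have hi := innerForm_le_of_lipschitz hN h0 h1 measurableSet_ball
    (measure_ball_lt_top (x := a) (r := η)).ne h2 tent_nonneg tent_eq_zero tent_lipschitz
  have hl := abs_lowerForm_self_le hN hΩ hbdd h2 hH.eq_zero
  have hge := integral_tent_sq_ge h0 h2
  rw [volume_real_ball h0] at hi
  rw [logForm_eq]
  have : 1 ^ 2 * (η ^ N * ballVol N) * η ^ 2 = ballVol N * η ^ (N + 2) := by ring
  linarith [(abs_le.1 hl).2]

end Tent

/-! ### Trial functions and density of the form domain -/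

section Trial

variable {Ω : Set (EuclideanSpace ℝ (Fin N))}

theorem exists_mem_formDomain (hN : 1 ≤ N) (hΩ : MeasurableSet Ω) (hbdd : Bornology.IsBounded Ω)
    {u : EuclideanSpace ℝ (Fin N) → ℝ} (hu : MemH Ω u) :
    ∃ f : formDomain hΩ, zeroExt f.1 =ᵐ[volume] u := by
  have hm := (hu.memLp hN hΩ hbdd).restrict Ω
  have h := zeroExt_ae hΩ hm.coeFn_toLp hu.eq_zero
  exact ⟨⟨hm.toLp u, hu.congr h.symm (zeroExt_of_notMem _)⟩, h⟩

/-- Any number of disjoint balls of comparable radius fits into an open set. -/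
theorem exists_disjoint_balls (hN : 1 ≤ N) (hopen : IsOpen Ω) (hne : Ω.Nonempty) :
    ∃ C : ℝ, ∀ k : ℕ, 1 ≤ k → ∃ (η : ℝ) (a : Fin k → EuclideanSpace ℝ (Fin N)), 0 < η ∧ η ≤ 1 ∧
      Real.log η⁻¹ ≤ 1 / N * Real.log k + C ∧ (∀ i, Metric.ball (a i) η ⊆ Ω) ∧
      ∀ i j, i ≠ j → Disjoint (Metric.ball (a i) η) (Metric.ball (a j) η) := by
  obtain ⟨x, hx⟩ := hne
  obtain ⟨R, hR, hball⟩ := Metric.isOpen_iff.1 hopen x hx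
  set r := min 1 R
  have hr : 0 < r := lt_min one_pos hR
  have hN1 : (1 : ℝ) ≤ N := by exact_mod_cast hN
  refine ⟨Real.log (3 * N / r) + Real.log 2, fun k hk => ?_⟩
  have hk1 : (1 : ℝ) ≤ k := by exact_mod_cast hk
  have hk0 : (0 : ℝ) < k := by linarith
  set s : ℝ := (k : ℝ) ^ (1 / N : ℝ)
  have hs1 : 1 ≤ s := Real.one_le_rpow hk1 (by positivity)
  set m := ⌈s⌉₊
  have hsm : s ≤ m := Nat.le_ceil s
  have hm1 : (1 : ℝ) ≤ m := hs1.trans hsm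
  have hm2 : (m : ℝ) ≤ 2 * s := by linarith [Nat.ceil_lt_add_one (zero_le_one.trans hs1)]
  have hkm : k ≤ m ^ N := by
    have h1 : s ^ N = k := by
      rw [← Real.rpow_natCast, ← Real.rpow_mul hk0.le, one_div_mul_cancel (by positivity),
        Real.rpow_one]
    have h2 : (k : ℝ) ≤ (m : ℝ) ^ N := h1 ▸ pow_le_pow_left₀ (by positivity) hsm N
    exact_mod_cast h2
  obtain ⟨z⟩ : Nonempty (Fin k ↪ (Fin N → Fin m)) :=
    Function.Embedding.nonempty_of_card_le (by simpa using hkm)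
  -- Centres lie on a grid of spacing 2η with m^N ≥ k points. Offsets from x have norm at most 2ηNm
  -- = 2r/3 and η ≤ r/3, so all balls lie in the ball of radius r about x.
  set η : ℝ := r / (3 * N * m)
  have hη : 0 < η := by positivity
  have hηm : η * (3 * N * m) = r := div_mul_cancel₀ _ (by positivity)
  have hNm : 1 ≤ (N : ℝ) * m := one_le_mul_of_one_le_of_one_le hN1 hm1
  have hη3 : 3 * (η * (N * m)) = r := by rw [← hηm]; ring
  have hηle : η ≤ η * (N * m) := le_mul_of_one_le_right hη.le hNm
  set w : Fin k → EuclideanSpace ℝ (Fin N) :=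
    fun i => WithLp.toLp 2 fun l => 2 * η * ((z i l : ℕ) : ℝ)
  have hw : ∀ i, ‖w i‖ ≤ 2 * (η * (N * m)) := fun i => by
    rw [EuclideanSpace.norm_eq]
    refine Real.sqrt_le_iff.2 ⟨by positivity, ?_⟩
    have h1 : ∀ l, ‖w i l‖ ^ 2 ≤ (2 * η * m) ^ 2 := fun l => by
      have h2 : ((z i l : ℕ) : ℝ) ≤ m := by exact_mod_cast (z i l).2.le
      rw [Real.norm_eq_abs, sq_abs]
      exact pow_le_pow_left₀ (by positivity) (mul_le_mul_of_nonneg_left h2 (by positivity)) 2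
    refine (Finset.sum_le_sum fun l _ => h1 l).trans ?_
    rw [Finset.sum_const, Finset.card_univ, Fintype.card_fin, nsmul_eq_mul]
    have : (N : ℝ) * (2 * η * m) ^ 2 ≤ (N * N) * (2 * η * m) ^ 2 :=
      mul_le_mul_of_nonneg_right (by nlinarith) (by positivity)
    exact this.trans_eq (by ring)
  refine ⟨η, fun i => x + w i, hη, ?_, ?_, fun i y hy => hball ?_, fun i j hij => ?_⟩
  · have : r ≤ 1 := min_le_left _ _
    linarith
  · have h1 : η⁻¹ = 3 * N / r * m := by simp only [η]; field_simp
    have h2 : Real.log s = 1 / N * Real.log k := Real.log_rpow hk0 _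
    rw [h1, Real.log_mul (by positivity) (by positivity)]
    have h3 := Real.log_le_log (by positivity) hm2
    rw [Real.log_mul two_ne_zero (by positivity), h2] at h3
    linarith
  · rw [mem_ball_iff_norm] at hy ⊢
    have h1 : ‖y - x‖ ≤ ‖y - (x + w i)‖ + ‖w i‖ := by
      have := norm_add_le (y - (x + w i)) (w i)
      rwa [show y - (x + w i) + w i = y - x by abel] at this
    have h2 : r ≤ R := min_le_right _ _
    linarith [hw i]
  · refine Metric.ball_disjoint_ball ?_
    obtain ⟨l, hl⟩ := Function.ne_iff.1 (z.injective.ne hij)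
    have hl' : ((z i l : ℕ) : ℤ) ≠ (z j l : ℕ) := fun h => hl (Fin.ext (by exact_mod_cast h))
    have h1 : (1 : ℝ) ≤ |((z i l : ℕ) : ℝ) - ((z j l : ℕ) : ℝ)| := by
      have := Int.one_le_abs (sub_ne_zero.2 hl')
      exact_mod_cast this
    rw [dist_eq_norm, add_sub_add_left_eq_sub]
    refine le_trans ?_ (PiLp.norm_apply_le (w i - w j) l)
    have h2 : (w i - w j) l = 2 * η * (((z i l : ℕ) : ℝ) - ((z j l : ℕ) : ℝ)) := by
      simp only [w, PiLp.sub_apply]; ring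
    rw [h2, Real.norm_eq_abs, abs_mul, abs_of_pos (by positivity)]
    nlinarith

/-- Orthonormal systems of trial functions with almost optimal trace. -/
theorem exists_trial (hN : 1 ≤ N) (hΩ : MeasurableSet Ω) (hbdd : Bornology.IsBounded Ω)
    (hopen : IsOpen Ω) (hne : Ω.Nonempty) :
    ∃ C : ℝ, ∀ k : ℕ, 1 ≤ k → ∃ ψ : Fin k → formDomain hΩ, Orthonormal ℝ ψ ∧
      ∑ i, formMap hN hΩ hbdd (ψ i) (ψ i) ≤ k * (2 / N * Real.log k + C) := by
  obtain ⟨C, hC⟩ := exists_disjoint_balls hN hopen hne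
  refine ⟨2 * C + (2 ^ (N + 2) + lowerConst N Ω), fun k hk => ?_⟩
  obtain ⟨η, a, h0, h1, hlog, hball, hdisj⟩ := hC k hk
  choose f hf using fun i => exists_mem_formDomain hN hΩ hbdd (tent_memH hN (hball i))
  have hinner : ∀ i j, inner ℝ (f i) (f j) = ∫ x, tent (a i) η x * tent (a j) η x := fun i j => by
    rw [Submodule.coe_inner, inner_eq_integral_zeroExt hΩ]
    refine integral_congr_ae ?_
    filter_upwards [hf i, hf j] with x hx hy
    rw [hx, hy]
  have hnorm : ∀ i, ‖f i‖ ^ 2 = ∫ x, tent (a i) η x ^ 2 := fun i => by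
    rw [← real_inner_self_eq_norm_sq, hinner]
    simp only [sq]
  have hpos : ∀ i, 0 < ‖f i‖ := fun i => by
    have h2 := integral_tent_sq_ge h0 ((tent_memH hN (hball i)).memLp hN hΩ hbdd)
    rw [← hnorm] at h2
    have h3 : 0 < ballVol N * η ^ (N + 2) := mul_pos ballVol_pos (by positivity)
    have h4 : ‖f i‖ ≠ 0 := fun h => by rw [h] at h2; norm_num at h2; linarith
    exact (norm_nonneg _).lt_of_ne' h4
  refine ⟨fun i => ‖f i‖⁻¹ • f i, ⟨fun i => ?_, fun i j hij => ?_⟩, ?_⟩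
  · rw [norm_smul, norm_inv, norm_norm, inv_mul_cancel₀ (hpos i).ne']
  · have h2 : ∀ x, tent (a i) η x * tent (a j) η x = 0 := fun x => by
      by_cases hx : x ∈ Metric.ball (a i) η
      · rw [tent_eq_zero (a := a j) x (Set.disjoint_left.1 (hdisj i j hij) hx), mul_zero]
      · rw [tent_eq_zero x hx, zero_mul]
    have h3 : inner ℝ (f i : LTwo Ω) (f j : LTwo Ω) = 0 := by
      rw [← Submodule.coe_inner, hinner]
      simp [h2]
    beta_reduce
    rw [Submodule.coe_inner, Submodule.coe_smul, Submodule.coe_smul, real_inner_smul_left,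
      real_inner_smul_right, h3, mul_zero, mul_zero]
  · have h2 : ∀ i, formMap hN hΩ hbdd (‖f i‖⁻¹ • f i) (‖f i‖⁻¹ • f i) ≤
        2 / N * Real.log k + (2 * C + (2 ^ (N + 2) + lowerConst N Ω)) := fun i => by
      have h3 := tent_logForm_le hN hΩ hbdd h0 h1 (hball i)
      rw [← hnorm, ← logForm_congr_left (hf i), ← logForm_congr_right (hf i),
        ← formMap_apply hN hΩ hbdd] at h3
      simp only [map_smul, LinearMap.smul_apply, smul_eq_mul]
      calc ‖f i‖⁻¹ * (‖f i‖⁻¹ * formMap hN hΩ hbdd (f i) (f i))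
          ≤ ‖f i‖⁻¹ * (‖f i‖⁻¹ * ((2 * Real.log η⁻¹ + (2 ^ (N + 2) + lowerConst N Ω)) *
            ‖f i‖ ^ 2)) := by gcongr
        _ = 2 * Real.log η⁻¹ + (2 ^ (N + 2) + lowerConst N Ω) := by
            have := (hpos i).ne'
            field_simp
        _ ≤ _ := by
            have : 2 * (1 / (N : ℝ) * Real.log k + C) = 2 / N * Real.log k + 2 * C := by ring
            linarith
    refine (Finset.sum_le_sum fun i _ => h2 i).trans_eq ?_
    rw [Finset.sum_const, Finset.card_univ, Fintype.card_fin, nsmul_eq_mul]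

theorem not_finiteDimensional_formDomain (hN : 1 ≤ N) (hΩ : MeasurableSet Ω)
    (hbdd : Bornology.IsBounded Ω) (hopen : IsOpen Ω) (hne : Ω.Nonempty) :
    ¬ FiniteDimensional ℝ (formDomain hΩ) := by
  intro hfin
  obtain ⟨C, hC⟩ := exists_trial hN hΩ hbdd hopen hne
  obtain ⟨ψ, hψ, -⟩ := hC (Module.finrank ℝ (formDomain hΩ) + 1) (Nat.succ_pos _)
  have := hψ.linearIndependent.fintype_card_le_finrank
  rw [Fintype.card_fin] at this
  omega

/-- The form domain is dense in `L²(Ω)`. -/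
theorem formDomain_orthogonal (hN : 1 ≤ N) (hΩ : MeasurableSet Ω) (hbdd : Bornology.IsBounded Ω)
    (hopen : IsOpen Ω) : (formDomain hΩ)ᗮ = ⊥ := by
  rw [Submodule.eq_bot_iff]
  intro g hg
  have hgi := integrable_of_memLp hbdd (zeroExt_memLp hΩ g) (zeroExt_of_notMem g)
  -- Smooth functions compactly supported in Ω are Lipschitz, hence in the form domain, so g
  -- integrates to zero against all of them.
  have h := hopen.ae_eq_zero_of_integral_contDiff_smul_eq_zero (f := zeroExt g) (μ := volume)
    (hgi.locallyIntegrable.locallyIntegrableOn Ω) fun φ hφ hc hs => by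
      obtain ⟨K, hK⟩ := ContDiff.lipschitzWith_of_hasCompactSupport hc hφ (by simp)
      have hH : MemH Ω φ := memH_of_lipschitz (K := K) hN hc.isCompact.measurableSet
        hc.isCompact.measure_lt_top.ne hs hφ.continuous.measurable.aemeasurable
        (fun x hx => image_eq_zero_of_notMem_tsupport hx) fun x y => by
          have := hK.dist_le_mul x y
          rwa [Real.dist_eq, dist_eq_norm] at this
      obtain ⟨f, hf⟩ := exists_mem_formDomain hN hΩ hbdd hH
      have h1 := (Submodule.mem_orthogonal _ g).1 hg f f.2
      rw [inner_eq_integral_zeroExt hΩ] at h1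
      rw [← h1]
      refine integral_congr_ae ?_
      filter_upwards [hf] with x hx
      rw [hx, smul_eq_mul]
  have h2 : zeroExt g =ᵐ[volume] 0 := by
    filter_upwards [h] with x hx
    by_cases hxΩ : x ∈ Ω
    · exact hx hxΩ
    · exact zeroExt_of_notMem g x hxΩ
  rw [← norm_eq_zero, ← sq_eq_zero_iff, ← integral_zeroExt_sq hΩ]
  refine integral_eq_zero_of_ae ?_
  filter_upwards [h2] with x hx
  simp [hx]

end Trial

/-! ### Existence of eigenvalues and their asymptotics -/

section Main

variable {Ω : Set (EuclideanSpace ℝ (Fin N))}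

theorem exists_eigenvalueSequence (hN : 1 ≤ N) (hbdd : Bornology.IsBounded Ω) (hopen : IsOpen Ω)
    (hne : Ω.Nonempty) : ∃ lam : ℕ → ℝ, IsDirichletEigenvalueSequence Ω lam := by
  have hΩ := hopen.measurableSet
  obtain ⟨lam, e, he, hexp⟩ := exists_eigenfamily (B := formMap hN hΩ hbdd)
    (fun u v => logForm_comm) (not_finiteDimensional_formDomain hN hΩ hbdd hopen hne)
    (formCompact_formMap hN hΩ hbdd) (formMap_bddBelow hN hΩ hbdd)
  have horth : Orthonormal ℝ fun k => (e k : LTwo Ω) :=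
    he.orthonormal.comp_linearIsometry (formDomain hΩ).subtypeₗᵢ
  -- A vector orthogonal to all e k is orthogonal to the partial sums, hence to their limits, which
  -- exhaust the dense form domain.
  have hbot : (Submodule.span ℝ (Set.range fun k => (e k : LTwo Ω)))ᗮ = ⊥ := by
    rw [Submodule.eq_bot_iff]
    intro x hx
    have h1 : x ∈ (formDomain hΩ)ᗮ := by
      refine (Submodule.mem_orthogonal _ x).2 fun u hu => ?_
      have h2 := ((continuous_subtype_val.tendsto _).comp (hexp ⟨u, hu⟩)).inner (𝕜 := ℝ)
        (tendsto_const_nhds (x := x))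
      refine tendsto_nhds_unique h2 (tendsto_const_nhds.congr fun n => Eq.symm ?_)
      rw [Function.comp_apply, partialSum, Submodule.coe_sum, sum_inner]
      refine Finset.sum_eq_zero fun j _ => ?_
      rw [Submodule.coe_smul, inner_smul_left,
        (Submodule.mem_orthogonal _ x).1 hx _ (Submodule.subset_span ⟨j, rfl⟩), mul_zero]
    rwa [formDomain_orthogonal hN hΩ hbdd hopen] at h1
  refine ⟨lam, he.mono, HilbertBasis.mkOfOrthogonalEqBot horth hbot, fun k =>
    ⟨zeroExt (e k : LTwo Ω), ⟨(e k).2, fun h => ?_, fun φ hφ => ?_⟩, ?_⟩⟩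
  · have h1 := integral_zeroExt_sq hΩ (e k : LTwo Ω)
    have h2 : ∫ x, zeroExt (e k : LTwo Ω) x ^ 2 = 0 := by
      refine integral_eq_zero_of_ae ?_
      filter_upwards [h] with x hx
      simp [hx]
    rw [h2, horth.1 k] at h1
    norm_num at h1
  · obtain ⟨g, hg⟩ := exists_mem_formDomain hN hΩ hbdd hφ
    rw [← logForm_congr_right hg, ← formMap_apply hN hΩ hbdd, he.weak_eq, Submodule.coe_inner,
      inner_eq_integral_zeroExt hΩ, setIntegral_eq_integral_of_forall_compl_eq_zero fun x hx => by
        rw [zeroExt_of_notMem _ x hx, zero_mul]]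
    congr 1
    refine integral_congr_ae ?_
    filter_upwards [hg] with x hx
    rw [hx]
  · rw [HilbertBasis.coe_mkOfOrthogonalEqBot]
    filter_upwards [ae_restrict_mem hΩ] with x hx
    rw [zeroExt, Set.indicator_of_mem hx]

/-- Returns any admissible sequence to the abstract setting, so the asymptotics hold for every such
sequence and not only for the one built by minimization. -/
theorem IsDirichletEigenvalueSequence.exists_eigenfamily {lam : ℕ → ℝ} (hN : 1 ≤ N)
    (hΩ : MeasurableSet Ω) (hbdd : Bornology.IsBounded Ω)
    (h : IsDirichletEigenvalueSequence Ω lam) :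
    ∃ e : ℕ → formDomain hΩ, IsEigenfamily (formMap hN hΩ hbdd) lam e ∧
      ∀ u, Tendsto (partialSum e u) atTop (𝓝 u) := by
  obtain ⟨hmono, b, hb⟩ := h
  choose u hu hub using hb
  have hext : ∀ k, zeroExt (b k) =ᵐ[volume] u k := fun k =>
    zeroExt_ae hΩ (hub k).symm (hu k).memH.eq_zero
  have hmem : ∀ k, b k ∈ formDomain hΩ := fun k =>
    (hu k).memH.congr (hext k).symm (zeroExt_of_notMem _)
  refine ⟨fun k => ⟨b k, hmem k⟩, ⟨hmono, ⟨fun k => b.orthonormal.1 k,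
    fun i j hij => b.orthonormal.2 hij⟩, fun k v => ?_⟩, fun v => ?_⟩
  · rw [formMap_apply, logForm_congr_left (hext k), (hu k).weak_eq _ v.2, Submodule.coe_inner,
      inner_eq_setIntegral]
    congr 1
    refine integral_congr_ae ?_
    filter_upwards [hub k, ae_restrict_mem hΩ] with x hx hxΩ
    rw [hx, zeroExt, Set.indicator_of_mem hxΩ]
  · have h1 := (b.hasSum_repr (v : LTwo Ω)).tendsto_sum_nat
    refine tendsto_subtype_rng.2 (h1.congr fun n => ?_)
    rw [partialSum, Submodule.coe_sum]
    refine Finset.sum_congr rfl fun j _ => ?_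
    rw [b.repr_apply_apply]
    rfl

theorem IsDirichletEigenvalueSequence.tendsto_div_log {lam : ℕ → ℝ} (hN : 1 ≤ N)
    (hbdd : Bornology.IsBounded Ω) (hopen : IsOpen Ω) (hne : Ω.Nonempty)
    (h : IsDirichletEigenvalueSequence Ω lam) :
    Tendsto (fun k : ℕ => lam k / Real.log ((k : ℝ) + 1)) atTop (𝓝 (2 / (N : ℝ))) := by
  have hΩ := hopen.measurableSet
  obtain ⟨e, he, hexp⟩ := h.exists_eigenfamily hN hΩ hbdd
  obtain ⟨C₁, hC₁⟩ := trace_ge hN hΩ hbdd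
  obtain ⟨C₂, hC₂⟩ := exists_trial hN hΩ hbdd hopen hne
  have hself : ∀ k, formMap hN hΩ hbdd (e k) (e k) = lam k := fun k => by
    rw [he.weak_eq, real_inner_self_eq_norm_sq, he.orthonormal.1, one_pow, mul_one]
  refine tendsto_div_log_of_sum_bounds he.mono (C := max C₁ C₂) (fun k hk => ?_) fun k hk => ?_
  · have h1 := hC₁ k hk (fun i => e i) (he.orthonormal.comp _ Fin.val_injective)
    simp only [hself, Fin.sum_univ_eq_sum_range lam k] at h1
    refine le_trans ?_ h1
    gcongr
    exact le_max_left _ _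
  · obtain ⟨ψ, hψ, hle⟩ := hC₂ k hk
    refine (he.sum_le_trace (fun u v => logForm_comm) (formMap_bddBelow hN hΩ hbdd) hexp hψ).trans
      (hle.trans ?_)
    gcongr
    exact le_max_right _ _

end Main

end LogLaplacian

end

theorem mainTheorem1 (N : ℕ) (hN : 1 ≤ N) (Ω : Set (EuclideanSpace ℝ (Fin N)))
    (hopen : IsOpen Ω) (hconn : IsConnected Ω) (hbdd : Bornology.IsBounded Ω) :
    (∃ lam : ℕ → ℝ, LogLaplacian.IsDirichletEigenvalueSequence Ω lam) ∧
      ∀ lam : ℕ → ℝ, LogLaplacian.IsDirichletEigenvalueSequence Ω lam →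
        Tendsto (fun k : ℕ => lam k / Real.log ((k : ℝ) + 1)) atTop (𝓝 (2 / (N : ℝ))) := by
  exact ⟨LogLaplacian.exists_eigenvalueSequence hN hbdd hopen hconn.nonempty,
    fun lam h => h.tendsto_div_log hN hbdd hopen hconn.nonempty⟩
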